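/- An exponential field $(\mathcal R,\exp)$ is an ordered field $\mathcal R$ with domain $R$ together with an order-preserving isomorphism $\exp$ from $(R,+)$ onto $(R^{>0},\cdot)$. Let $\mathcal L_{OR}(\exp)$ be the language $(+,\cdot,0,1,\leqslant,\exp)$. Let $\mathsf{MaxVal}(\exp)$ be the scheme consisting, for every $\mathcal L_{OR}(\exp)$-term $t(z,\overline w)$, of $$\forall\overline w\,\forall x,y\,\bigl(x<y\rightarrow\exists z_{\max}\in[x,y]\ \forall z\in[x,y]\ \ t(z,\overline w)\leqslant t(z_{\max},\overline w)\bigr),$$ and let $\mathsf{IntVal}(\exp)$ be the scheme consisting, for every such term $t$, of $$\forall\overline w\,\forall x,y\,\bigl(x<y\wedge t(x,\overline w)\leqslant 0\wedge t(y,\overline w)\geqslant 0\rightarrow\exists z\in[x,y]\ \ t(z,\overline w)=0\bigr).$$ An exponential integer part of $(\mathcal R,\exp)$ is a subring $\mathcal M\subseteq\mathcal R$, with domain $M$, in which $1$ is the least positive element, such that for every $r\in R$ there is $m\in M$ with $m\leqslant r<m+1$, and such that $\exp(m)\in M^+$ for all $m\in M^+:=\{m\in M: m\geqslant 0\}$.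 Then $(\mathcal M^+,\exp)$ denotes the ordered semiring $M^+$ with the restriction of $\exp$ and with $S(x)=x+1$. Let $\mathsf{IOpen}(\exp)$ be the theory in the language $(0,S,+,\cdot,\leqslant,\exp)$ consisting of Robinson's arithmetic $\mathsf Q$, namely $$Sx\neq 0,\quad Sx=Sy\rightarrow x=y,\quad x\neq 0\rightarrow\exists y\,(x=Sy),\quad x+0=x,\quad x+Sy=S(x+y),$$ $$x\cdot 0=0,\quad x\cdot Sy=x\cdot y+x,\quad x\leqslant y\leftrightarrow\exists r\,(r+x=y),$$ the axioms $\exp(0)=S(0)$ and $\exp(S(x))=\exp(x)+\exp(x)$, and the induction scheme $$\varphi(0,\overline y)\wedge\forall x\,\bigl(\varphi(x,\overline y)\rightarrow\varphi(S(x),\overline y)\bigr)\rightarrow\forall x\,\varphi(x,\overline y)$$ for all quantifier-free formulas $\varphi(x,\overline y)$ of this language. **Theorem.** Let $(\mathcal R,\exp)$ be an exponential field satisfying $\mathsf{MaxVal}(\exp)$ and $\exp(1)=2$. Then: 1. for every exponential integer part $(\mathcal M,\exp)$ of $(\mathcal R,\exp)$, the structure $(\mathcal M^+,\exp)$ is a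 model of $\mathsf{IOpen}(\exp)$; 2. $(\mathcal R,\exp)$ is a model of $\mathsf{IntVal}(\exp)$; 3. for all $\mathcal L_{OR}(\exp)$-terms $t_1(x,\overline w)$, $t_2(x,\overline w)$ and all parameters $\overline a$ from $R$, the set $\{x\in R: t_1(x,\overline a)\leqslant t_2(x,\overline a)\}$ is a finite union of points and open intervals with endpoints in $R\cup\{-\infty,+\infty\}$. -/

import Mathlib

open FirstOrder FirstOrder.Language

/-! ### The two languages -/

/-- Function symbols of the arithmetical language with exponentiation: `0`, `S`, `+`, `·`, `exp`. -/
inductive ArExpFunc : ℕ → Type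
  | zero : ArExpFunc 0
  | succ : ArExpFunc 1
  | add : ArExpFunc 2
  | mul : ArExpFunc 2
  | exp : ArExpFunc 1

/-- Function symbols of the language of ordered rings with exponentiation:
`0`, `1`, `+`, `·`, `exp` (there is no symbol for subtraction). -/
inductive OrExpFunc : ℕ → Type
  | zero : OrExpFunc 0
  | one : OrExpFunc 0
  | add : OrExpFunc 2
  | mul : OrExpFunc 2
  | exp : OrExpFunc 1

/-- The only relation symbol of both languages (besides equality) is the binary `≤`. -/
inductive LeRel : ℕ → Type
  | le : LeRel 2

/-- The arithmetical language `(0, S, +, ·, ≤)` expanded by `exp`. -/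
def LArExp : FirstOrder.Language.{0, 0} := ⟨ArExpFunc, LeRel⟩

/-- The language of ordered rings `(+, ·, 0, 1, ≤)` expanded by `exp`. -/
def LOrExp : FirstOrder.Language.{0, 0} := ⟨OrExpFunc, LeRel⟩

instance : LArExp.IsOrdered := ⟨LeRel.le⟩

instance : LOrExp.IsOrdered := ⟨LeRel.le⟩

/-! ### Closing a formula -/

/-- The universal closure of a formula with free variables indexed by `Fin n`. -/
noncomputable def univClosure {L : FirstOrder.Language.{0, 0}} {n : ℕ} (φ : L.Formula (Fin n)) :
    L.Sentence :=
  Formula.iAlls (α := Empty) (Fin n) (φ.relabel Sum.inr)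

/-! ### The theory of open induction with exponentiation -/

namespace ArExp

variable {α : Type}

/-- The term `0`. -/
def zero : LArExp.Term α := Term.func (L := LArExp) (l := 0) ArExpFunc.zero Fin.elim0

/-- The term `S t`. -/
def succ (t : LArExp.Term α) : LArExp.Term α := Functions.apply₁ (L := LArExp) ArExpFunc.succ t

/-- The term `exp t`. -/
def exp (t : LArExp.Term α) : LArExp.Term α := Functions.apply₁ (L := LArExp) ArExpFunc.exp t

/-- The term `t + s`. -/
def add (t s : LArExp.Term α) : LArExp.Term α := Functions.apply₂ (L := LArExp) ArExpFunc.add t s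

/-- The term `t · s`. -/
def mul (t s : LArExp.Term α) : LArExp.Term α := Functions.apply₂ (L := LArExp) ArExpFunc.mul t s

/-- Robinson's arithmetic `Q`. -/
def robinsonQ : LArExp.Theory :=
  { ∀' ∼(succ (&0) =' zero),
    ∀' ∀' ((succ (&0) =' succ (&1)) ⟹ ((&0) =' (&1))),
    ∀' (∼((&0) =' zero) ⟹ ∃' ((&0) =' succ (&1))),
    ∀' (add (&0) zero =' (&0)),
    ∀' ∀' (add (&0) (succ (&1)) =' succ (add (&0) (&1))),
    ∀' (mul (&0) zero =' zero),
    ∀' ∀' (mul (&0) (succ (&1)) =' add (mul (&0) (&1)) (&0)),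
    ∀' ∀' ((Term.le (&0) (&1)) ⇔ ∃' (add (&2) (&0) =' (&1))) }

/-- The axioms `exp 0 = S 0` and `exp (S x) = exp x + exp x`. -/
def expAxioms : LArExp.Theory :=
  { exp zero =' succ zero,
    ∀' (exp (succ (&0)) =' add (exp (&0)) (exp (&0))) }

/-- The induction axiom for `φ(x, ȳ)`: the universal closure of
`φ(0, ȳ) ∧ ∀ x (φ(x, ȳ) → φ(S x, ȳ)) → ∀ x φ(x, ȳ)`.
The parameters `ȳ` are the variables `Sum.inl i`, the induction variable is `Sum.inr ()`. -/
noncomputable def induction {n : ℕ} (φ : LArExp.Formula (Fin n ⊕ Unit)) : LArExp.Sentence :=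
  let φ0 : LArExp.Formula (Fin n) := φ.subst (Sum.elim Term.var fun _ => zero)
  let φS : LArExp.Formula (Fin n ⊕ Unit) :=
    φ.subst (Sum.elim (fun i => Term.var (Sum.inl i)) fun u => succ (Term.var (Sum.inr u)))
  univClosure ((φ0 ⊓ Formula.iAlls Unit (φ.imp φS)).imp (Formula.iAlls Unit φ))

/-- `IOpen(exp)`: Robinson's arithmetic, the axioms for `exp`, and induction for all
quantifier-free formulas in the language with `exp`. -/
noncomputable def IOpen : LArExp.Theory :=
  robinsonQ ∪ expAxioms ∪
    { σ | ∃ (n : ℕ) (φ : LArExp.Formula (Fin n ⊕ Unit)), φ.IsQF ∧ σ = induction φ }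

end ArExp

/-! ### Extreme value and intermediate value schemes -/

namespace OrExp

/-- The term `0`. -/
def zero {α : Type} : LOrExp.Term α := Term.func (L := LOrExp) (l := 0) OrExpFunc.zero Fin.elim0

/-- For a term `t(z, w̄)`, the term `t(s, w̄)`. The parameters `w̄` are the variables `Sum.inl i`,
the main variable is `Sum.inr ()`. -/
def plug {n m : ℕ} (t : LOrExp.Term (Fin n ⊕ Unit)) (s : LOrExp.Term (Fin n ⊕ Fin m)) :
    LOrExp.Term (Fin n ⊕ Fin m) :=
  t.subst (Sum.elim (fun i => Term.var (Sum.inl i)) fun _ => s)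

/-- The extreme value sentence of `t`: for all `w̄` and all `x < y` there is `z₁ ∈ [x, y]` with
`t(z, w̄) ≤ t(z₁, w̄)` for all `z ∈ [x, y]`.
Below `&0, &1, &2, &3` are `x, y, z₁, z`. -/
noncomputable def maxVal {n : ℕ} (t : LOrExp.Term (Fin n ⊕ Unit)) : LOrExp.Sentence :=
  univClosure (∀' ∀' ((Term.lt (&0) (&1)) ⟹
    ∃' (Term.le (&0) (&2) ⊓ Term.le (&2) (&1) ⊓
      ∀' ((Term.le (&0) (&3) ⊓ Term.le (&3) (&1)) ⟹ Term.le (plug t (&3)) (plug t (&2))))))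

/-- The intermediate value sentence of `t`: for all `w̄` and all `x < y` with `t(x, w̄) ≤ 0` and
`t(y, w̄) ≥ 0` there is `z ∈ [x, y]` with `t(z, w̄) = 0`.
Below `&0, &1, &2` are `x, y, z`. -/
noncomputable def intVal {n : ℕ} (t : LOrExp.Term (Fin n ⊕ Unit)) : LOrExp.Sentence :=
  univClosure (∀' ∀'
    ((Term.lt (&0) (&1) ⊓ Term.le (plug t (&0)) zero ⊓ Term.le zero (plug t (&1))) ⟹
      ∃' (Term.le (&0) (&2) ⊓ Term.le (&2) (&1) ⊓ (plug t (&2) =' zero))))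

/-- The scheme `MaxVal(exp)`. -/
def MaxVal : LOrExp.Theory := { σ | ∃ (n : ℕ) (t : LOrExp.Term (Fin n ⊕ Unit)), σ = maxVal t }

/-- The scheme `IntVal(exp)`. -/
def IntVal : LOrExp.Theory := { σ | ∃ (n : ℕ) (t : LOrExp.Term (Fin n ⊕ Unit)), σ = intVal t }

end OrExp

/-! ### Exponential fields, exponential integer parts, and the structures they carry -/

section Fields

variable {R : Type*} [Field R] [LinearOrder R] [IsStrictOrderedRing R]

/-- `(R, exp)` is an exponential field: `exp` is an order-preserving isomorphism from `(R, +)` onto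
the multiplicative group of positive elements of the ordered field `R`. -/
structure IsExponentialField (exp : R → R) : Prop where
  map_add : ∀ x y, exp (x + y) = exp x * exp y
  strictMono : StrictMono exp
  range_eq : Set.range exp = {y | 0 < y}

/-- `(R, exp)` as a structure in the language of ordered rings with exponentiation. -/
@[reducible] def orExpStructure (exp : R → R) : LOrExp.Structure R where
  funMap {n} (f : OrExpFunc n) := match f with
    | .zero => fun _ => 0
    | .one => fun _ => 1
    | .add => fun v => v 0 + v 1
    | .mul => fun v => v 0 * v 1
    | .exp => fun v => exp (v 0)
  RelMap {n} (r : LeRel n) := match r with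
    | .le => fun v => v 0 ≤ v 1

/-- `(R, exp) ⊨ T`. -/
def FieldModels (exp : R → R) (T : LOrExp.Theory) : Prop :=
  letI := orExpStructure exp
  R ⊨ T

/-- The value `t(x, w̄)` in `(R, exp)`. -/
def termValue (exp : R → R) {n : ℕ} (t : LOrExp.Term (Fin n ⊕ Unit)) (w : Fin n → R) (x : R) : R :=
  letI := orExpStructure exp
  t.realize (Sum.elim w fun _ => x)

/-- `(M, exp)` is an exponential integer part of `(R, exp)`: `M` is a discretely ordered subring
of `R`, every element of `R` has an integer part in `M`, and `exp` maps the nonnegative elements of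
`M` to nonnegative elements of `M`. -/
structure IsExpIntegerPart (exp : R → R) (M : Subring R) : Prop where
  discrete : ∀ m ∈ M, 0 < m → 1 ≤ m
  exists_floor : ∀ r : R, ∃ m ∈ M, m ≤ r ∧ r < m + 1
  exp_mem : ∀ m ∈ M, 0 ≤ m → exp m ∈ M ∧ 0 ≤ exp m

/-- `M⁺`, the semiring of nonnegative elements of `M`. -/
def nonnegPart (M : Subring R) : Subsemiring R := M.toSubsemiring ⊓ Subsemiring.nonneg R

/-- `(M⁺, exp)` as a structure in the arithmetical language with exponentiation,
where `S x = x + 1`. -/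
@[reducible] def arExpStructure {exp : R → R} {M : Subring R} (h : IsExpIntegerPart exp M) :
    LArExp.Structure (nonnegPart M) where
  funMap {n} (f : ArExpFunc n) := match f with
    | .zero => fun _ => 0
    | .succ => fun v => v 0 + 1
    | .add => fun v => v 0 + v 1
    | .mul => fun v => v 0 * v 1
    | .exp => fun v => ⟨exp (v 0), h.exp_mem (v 0) (v 0).2.1 (v 0).2.2⟩
  RelMap {n} (r : LeRel n) := match r with
    | .le => fun v => v 0 ≤ v 1

/-- `(M⁺, exp) ⊨ T`. -/
def IntegerPartModels {exp : R → R} {M : Subring R} (h : IsExpIntegerPart exp M)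
    (T : LArExp.Theory) : Prop :=
  letI := arExpStructure h
  nonnegPart M ⊨ T

/-- A point, or an open interval with endpoints in `R ∪ {-∞, +∞}`. -/
def IsPointOrInterval (s : Set R) : Prop :=
  (∃ a, s = {a}) ∨ (∃ a b, s = Set.Ioo a b) ∨ (∃ a, s = Set.Ioi a) ∨ (∃ a, s = Set.Iio a) ∨
    s = Set.univ

/-- A finite union of intervals and points. -/
def IsFiniteUnionOfIntervals (s : Set R) : Prop :=
  ∃ F : Set (Set R), F.Finite ∧ (∀ u ∈ F, IsPointOrInterval u) ∧ s = ⋃₀ F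

end Fields

/-! The field need not be complete, so suprema are unavailable; attained maxima replace them. Three
mechanisms carry the proof.

Maxima in place of suprema (`le_of_uniform_step`). The function `σ(y) = exp(-exp(-N y))` is nearly
the indicator of `y > 0` and stays inside the class of term functions. Maximising `(z - u) * σ(f z)`
finds a point near the right end of the region where `f` is not too negative. If every step of
length about `δ` keeps `f` above a threshold, that point must be near the right end of the segment.
With Lipschitz bounds this shows that a nonvanishing `f` has constant sign; with derivative bounds
it shows that a positive Wronskian makes a quotient increase.

Derivative of `exp` (`exists_tangent`). As `exp 1 = 2`, the function `x - exp x` takes equal values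
at `0` and `1` and a larger one at `1/2`, so it has an interior maximum on `[0, 1]`. There the
functional equation gives `1 + c x ≤ exp x` near `0`, and then `exp' = c * exp` with a uniform
quadratic remainder. Hence every term function has a derivative in the class.

Finiteness of zeros (`polyIn.isPiecewiseZero`). Each term function lies in a tower of algebras that
starts with polynomials and adjoins `e = exp ∘ h` one at a time. For `f = a + e g`, the Wronskian of
`f` and `a` is `e V`, where `V` has smaller degree in `e`. By induction `a`, `g`, `V` each vanish
identically or nowhere between finitely many points, and there `f / a` is constant or strictly
monotone, as in Rolle's argument.

So the sign of every term function is locally constant off a finite set. This gives the finite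
unions of intervals, and it gives open induction, since quantifier-free truth values change only at
finitely many places. Intermediate values follow from constancy of sign. -/

set_option linter.unusedSectionVars false

/-! ### Term functions, and maxima as a substitute for suprema -/

section ExpFun

variable {R : Type*} [Field R] [LinearOrder R] [IsStrictOrderedRing R]

/-- The one-variable functions built from constants and the identity by sums, products and `exp`. -/
inductive IsExpFun (exp : R → R) : (R → R) → Prop
  | const (a : R) : IsExpFun exp (fun _ => a)
  | id : IsExpFun exp (fun x => x)
  | add {f g : R → R} : IsExpFun exp f → IsExpFun exp g → IsExpFun exp (f + g)
  | mul {f g : R → R} : IsExpFun exp f → IsExpFun exp g → IsExpFun exp (f * g)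
  | exp {f : R → R} : IsExpFun exp f → IsExpFun exp (fun x => exp (f x))

/-- Every function of the class `IsExpFun exp` attains a maximum on every segment. -/
def AttainsMax (exp : R → R) : Prop :=
  ∀ f, IsExpFun exp f → ∀ x y, x ≤ y → ∃ m ∈ Set.Icc x y, ∀ z ∈ Set.Icc x y, f z ≤ f m

namespace IsExpFun

variable {exp f g : R → R}

theorem congr (hf : IsExpFun exp f) (h : ∀ x, g x = f x) : IsExpFun exp g := by
  rwa [show g = f from funext h]

theorem neg (hf : IsExpFun exp f) : IsExpFun exp (-f) :=
  ((const (-1)).mul hf).congr fun x => by simp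

theorem sub (hf : IsExpFun exp f) (hg : IsExpFun exp g) : IsExpFun exp (f - g) :=
  (hf.add hg.neg).congr fun x => by simp [sub_eq_add_neg]

end IsExpFun

namespace IsExponentialField

variable {exp : R → R}

theorem pos (h : IsExponentialField exp) (x : R) : 0 < exp x := by
  have : exp x ∈ Set.range exp := ⟨x, rfl⟩
  rwa [h.range_eq] at this

theorem exists_eq (h : IsExponentialField exp) {y : R} (hy : 0 < y) : ∃ x, exp x = y := by
  have : y ∈ Set.range exp := by rwa [h.range_eq]
  exact this

theorem map_zero (h : IsExponentialField exp) : exp 0 = 1 := by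
  have := h.map_add 0 0
  rw [add_zero] at this
  exact (mul_left_cancel₀ (h.pos 0).ne' (by rw [mul_one]; exact this)).symm

theorem map_mul_map_neg (h : IsExponentialField exp) (x : R) : exp x * exp (-x) = 1 := by
  rw [← h.map_add, add_neg_cancel, h.map_zero]

/-- A composite of exponentials that is close to `0` below `-θ` and close to `1` above `θ`. -/
theorem exists_sigmoid (h : IsExponentialField exp) {θ η : R} (hθ : 0 < θ) (hη : 0 < η)
    (hη1 : η < 1) : ∃ N : R, (∀ y, θ ≤ y → 1 - η ≤ exp (-1 * exp (-N * y))) ∧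
      (∀ y, y ≤ -θ → exp (-1 * exp (-N * y)) ≤ η) := by
  obtain ⟨a, ha⟩ := h.exists_eq (y := 1 - η) (by linarith)
  obtain ⟨b, hb⟩ := h.exists_eq hη
  have ha0 : a < 0 := by
    rw [← h.strictMono.lt_iff_lt, ha, h.map_zero]; linarith
  obtain ⟨c, hc⟩ := h.exists_eq (y := -a) (by linarith)
  obtain ⟨d, hd⟩ := h.exists_eq (y := max 1 (-b)) (by positivity)
  -- With `N = m / θ`, the inner exponent `-N y` is at most `-m ≤ c` for `y ≥ θ` and at least `m ≥
  -- d` for `y ≤ -θ`.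
  set m := max (max (-c) d) 0 with hm
  have hm0 : 0 ≤ m := le_max_right _ _
  have hmc : -c ≤ m := (le_max_left _ _).trans (le_max_left _ _)
  have hmd : d ≤ m := (le_max_right _ _).trans (le_max_left _ _)
  refine ⟨m / θ, fun y hy => ?_, fun y hy => ?_⟩
  · rw [← ha]
    refine h.strictMono.monotone ?_
    have h1 : m ≤ m / θ * y := by
      calc m = m / θ * θ := by field_simp
        _ ≤ _ := by gcongr
    have h2 : exp (-(m / θ) * y) ≤ exp c := h.strictMono.monotone (by linarith)
    linarith
  · rw [← hb]
    refine h.strictMono.monotone ?_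
    have h1 : m ≤ m / θ * (-y) := by
      calc m = m / θ * θ := by field_simp
        _ ≤ _ := by gcongr; linarith
    have h2 : exp d ≤ exp (-(m / θ) * y) := h.strictMono.monotone (by linarith)
    have h3 : -b ≤ exp d := hd ▸ le_max_right _ _
    linarith

/-- A function that cannot fall below a threshold in steps of a fixed size stays above it. -/
theorem le_of_uniform_step (h : IsExponentialField exp) (hmax : AttainsMax exp) {f : R → R}
    (hf : IsExpFun exp f) {u v θ δ : R} (hθ : 0 < θ) (hδ : 0 < δ) (huv : u + δ ≤ v)
    (hu : -θ ≤ f u)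
    (step : ∀ z w, u ≤ z → w ≤ v → z + δ ≤ w → w ≤ z + 2 * δ → -θ ≤ f z → θ ≤ f w) :
    θ ≤ f v := by
  by_cases hv : v ≤ u + 2 * δ
  · exact step u v le_rfl le_rfl huv hv hu
  push Not at hv
  have hfu : θ ≤ f (u + δ) := step u _ le_rfl huv le_rfl (by linarith) hu
  -- Chosen so that an error `η` in `σ`, weighted by a length up to `v - u`, costs at most half a
  -- step.
  set η := δ / (2 * (v - u)) with hη
  have hL : 0 < v - u := by linarith
  have hη0 : 0 < η := by positivity
  have hηL : (v - u) * η = δ / 2 := by rw [hη]; field_simp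
  have hη1 : η < 1 := by
    rw [hη, div_lt_one (by positivity)]; linarith
  obtain ⟨N, hN1, hN2⟩ := h.exists_sigmoid hθ hη0 hη1
  set σ : R → R := fun y => exp (-1 * exp (-N * y)) with hσ
  have hσpos : ∀ y, 0 < σ y := fun y => h.pos _
  have hσlt : ∀ y, σ y < 1 := fun y => by
    rw [← h.map_zero]
    refine h.strictMono ?_
    have := h.pos (-N * y)
    linarith
  have hs : IsExpFun exp (fun z => (z + -u) * σ (f z)) :=
    (((IsExpFun.id.add (.const (-u)))).mul
      (IsExpFun.exp ((IsExpFun.const (-1)).mul (.exp ((IsExpFun.const (-N)).mul hf))))).congr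
        fun x => rfl
  -- The left end gives a weight `δ` and `f ≥ θ`, hence a value to beat; the right end leaves room
  -- for a last step of length at least `δ`.
  obtain ⟨z, ⟨hz1, hz2⟩, hz⟩ := hmax _ hs (u + δ) (v - δ) (by linarith)
  have hstart := hz (u + δ) ⟨le_rfl, by linarith⟩
  -- Otherwise the value at `z` is at most `(v - u - δ) * η`, below the value at least `δ * (1 - η)`
  -- at `u + δ`.
  have hfz : -θ ≤ f z := by
    by_contra hlt
    push Not at hlt
    have h1 := hN2 (f z) hlt.le
    have h2 := hN1 _ hfu
    have h3 : (z + -u) * σ (f z) ≤ (v - u - δ) * η :=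
      mul_le_mul (by linarith) h1 (hσpos _).le (by linarith)
    have h4 : δ * (1 - η) ≤ (u + δ + -u) * σ (f (u + δ)) :=
      mul_le_mul (by linarith) h2 (by linarith) (by linarith)
    nlinarith
  -- Moving to `z + δ` would gain `δ` in the weight and lose at most `δ / 2` through `σ`, against
  -- maximality. So `z` lies within `2 * δ` of `v`, and one step ends the proof.
  by_cases hzv : z + δ ≤ v - δ
  · exfalso
    have h1 := step z (z + δ) (by linarith) (by linarith) le_rfl (by linarith) hfz
    have h2 := hN1 _ h1
    have h3 := hz (z + δ) ⟨by linarith, hzv⟩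
    have h4 : (z + -u + δ) * (1 - η) ≤ (z + δ + -u) * σ (f (z + δ)) :=
      mul_le_mul (by linarith) h2 (by linarith) (by linarith)
    have h5 : (z + -u) * σ (f z) ≤ (z + -u) * 1 :=
      mul_le_mul_of_nonneg_left (hσlt _).le (by linarith)
    have h6 : (z + -u + δ) * η ≤ (v - u) * η :=
      mul_le_mul_of_nonneg_right (by linarith) hη0.le
    linarith
  · exact step z v (by linarith) le_rfl (by linarith) (by linarith) hfz

end IsExponentialField

/-! ### Calculus with uniform remainders -/

/-- `f'` is a derivative of `f`, with a quadratic remainder that is uniform on every segment. -/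
def HasUniformDeriv (f f' : R → R) : Prop :=
  ∀ p q : R, ∃ K : R, 0 < K ∧ ∀ z ∈ Set.Icc p q, |f z| ≤ K ∧ |f' z| ≤ K ∧
    ∀ w ∈ Set.Icc p q, |f w - f z| ≤ K * |w - z| ∧
      |f w - f z - f' z * (w - z)| ≤ K * (w - z) ^ 2

namespace HasUniformDeriv

variable {f f' g g' : R → R}

theorem congr (hf : HasUniformDeriv f f') (h : ∀ x, g x = f x) (h' : ∀ x, g' x = f' x) :
    HasUniformDeriv g g' := by
  rwa [show g = f from funext h, show g' = f' from funext h']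

theorem const (a : R) : HasUniformDeriv (fun _ => a) (fun _ => 0) := by
  intro p q
  refine ⟨|a| + 1, by positivity, fun z _ => ⟨by simp, by simp; positivity, fun w _ => ?_⟩⟩
  constructor <;> simp <;> positivity

theorem id : HasUniformDeriv (fun x : R => x) (fun _ => 1) := by
  intro p q
  refine ⟨max |p| |q| + 1, by positivity, fun z hz => ⟨?_, ?_, fun w _ => ⟨?_, ?_⟩⟩⟩
  · exact (abs_le_max_abs_abs hz.1 hz.2).trans (by linarith)
  · simp
  · have : (0 : R) ≤ max |p| |q| := by positivity
    nlinarith [abs_nonneg (w - z)]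
  · simp; positivity

theorem add (hf : HasUniformDeriv f f') (hg : HasUniformDeriv g g') :
    HasUniformDeriv (f + g) (f' + g') := by
  intro p q
  obtain ⟨K, hK, hf⟩ := hf p q
  obtain ⟨L, hL, hg⟩ := hg p q
  refine ⟨K + L, by positivity, fun z hz => ?_⟩
  obtain ⟨f1, f2, f3⟩ := hf z hz
  obtain ⟨g1, g2, g3⟩ := hg z hz
  refine ⟨(abs_add_le _ _).trans (add_le_add f1 g1), (abs_add_le _ _).trans (add_le_add f2 g2),
    fun w hw => ⟨?_, ?_⟩⟩
  · have := (abs_add_le _ _).trans (add_le_add (f3 w hw).1 (g3 w hw).1)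
    rw [← add_mul] at this
    refine le_trans (le_of_eq ?_) this
    congr 1
    simp only [Pi.add_apply]
    ring
  · have := (abs_add_le _ _).trans (add_le_add (f3 w hw).2 (g3 w hw).2)
    rw [← add_mul] at this
    refine le_trans (le_of_eq ?_) this
    congr 1
    simp only [Pi.add_apply]
    ring

theorem mul (hf : HasUniformDeriv f f') (hg : HasUniformDeriv g g') :
    HasUniformDeriv (f * g) (f' * g + f * g') := by
  intro p q
  obtain ⟨K, hK, hf⟩ := hf p q
  obtain ⟨L, hL, hg⟩ := hg p q
  have hKL : 0 < K * L := by positivity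
  refine ⟨3 * (K * L), by positivity, fun z hz => ?_⟩
  obtain ⟨f1, f2, f3⟩ := hf z hz
  obtain ⟨g1, g2, g3⟩ := hg z hz
  have key : ∀ {a b c d : R}, |a| ≤ c → |b| ≤ d → |a * b| ≤ c * d := fun ha hb => by
    rw [abs_mul]; exact mul_le_mul ha hb (abs_nonneg _) ((abs_nonneg _).trans ha)
  refine ⟨?_, ?_, fun w hw => ?_⟩
  · exact (key f1 g1).trans (by linarith)
  · exact (abs_add_le _ _).trans ((add_le_add (key f2 g1) (key f1 g2)).trans (by linarith))
  obtain ⟨f4, f5⟩ := f3 w hw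
  obtain ⟨g4, g5⟩ := g3 w hw
  obtain ⟨g6, -, -⟩ := hg w hw
  constructor
  · have h1 := (abs_add_le _ _).trans (add_le_add (key f4 g6) (key f1 g4))
    calc |(f * g) w - (f * g) z| = |(f w - f z) * g w + f z * (g w - g z)| := by
          congr 1; simp; ring
      _ ≤ _ := h1
      _ = 2 * (K * L) * |w - z| := by ring
      _ ≤ _ := mul_le_mul_of_nonneg_right (by linarith) (abs_nonneg _)
  · have h1 := (abs_add_le _ _).trans (add_le_add ((abs_add_le _ _).trans
      (add_le_add (key f5 g6) (key (key f2 (le_refl |w - z|)) g4))) (key f1 g5))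
    calc |(f * g) w - (f * g) z - (f' * g + f * g') z * (w - z)|
        = |(f w - f z - f' z * (w - z)) * g w + f' z * (w - z) * (g w - g z)
            + f z * (g w - g z - g' z * (w - z))| := by congr 1; simp; ring
      _ ≤ _ := h1
      _ = 2 * (K * L) * (w - z) ^ 2 + K * L * |w - z| ^ 2 := by ring
      _ = _ := by rw [sq_abs]; ring

theorem neg (hf : HasUniformDeriv f f') : HasUniformDeriv (-f) (-f') :=
  ((const (-1)).mul hf).congr (fun x => by simp) (fun x => by simp)

theorem comp (hf : HasUniformDeriv f f') (hg : HasUniformDeriv g g') :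
    HasUniformDeriv (fun x => f (g x)) (fun x => f' (g x) * g' x) := by
  intro p q
  obtain ⟨L, hL, hg⟩ := hg p q
  -- The bound on `g` included in `HasUniformDeriv` supplies a segment containing its values.
  obtain ⟨K, hK, hf⟩ := hf (-L) L
  have hmem : ∀ z ∈ Set.Icc p q, g z ∈ Set.Icc (-L) L := fun z hz => abs_le.1 (hg z hz).1
  refine ⟨K + K * L + K * L ^ 2, by positivity, fun z hz => ?_⟩
  obtain ⟨g1, g2, g3⟩ := hg z hz
  obtain ⟨f1, f2, f3⟩ := hf (g z) (hmem z hz)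
  have hKL : 0 < K * L := by positivity
  have hKL2 : 0 < K * L ^ 2 := by positivity
  refine ⟨f1.trans (by linarith), ?_, fun w hw => ?_⟩
  · rw [abs_mul]
    exact (mul_le_mul f2 g2 (abs_nonneg _) hK.le).trans (by linarith)
  obtain ⟨g4, g5⟩ := g3 w hw
  obtain ⟨f4, f5⟩ := f3 (g w) (hmem w hw)
  constructor
  · calc |f (g w) - f (g z)| ≤ K * (L * |w - z|) := f4.trans (by gcongr)
      _ = K * L * |w - z| := by ring
      _ ≤ _ := mul_le_mul_of_nonneg_right (by linarith) (abs_nonneg _)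
  · have h1 : (g w - g z) ^ 2 ≤ L ^ 2 * (w - z) ^ 2 := by
      rw [← sq_abs (g w - g z), ← sq_abs (w - z), ← mul_pow]
      gcongr
    calc |f (g w) - f (g z) - f' (g z) * g' z * (w - z)|
        = |(f (g w) - f (g z) - f' (g z) * (g w - g z))
            + f' (g z) * (g w - g z - g' z * (w - z))| := by congr 1; ring
      _ ≤ K * (L ^ 2 * (w - z) ^ 2) + K * (L * (w - z) ^ 2) := by
          refine (abs_add_le _ _).trans (add_le_add (f5.trans (by gcongr)) ?_)
          rw [abs_mul]
          exact mul_le_mul f2 g5 (abs_nonneg _) hK.le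
      _ ≤ _ := by nlinarith [mul_nonneg hK.le (sq_nonneg (w - z))]

end HasUniformDeriv

/-! ### The derivative of `exp` -/

namespace IsExponentialField

variable {exp : R → R}

/-- `exp` lies above a line through `(0, 1)` with positive slope near `0`. -/
theorem exists_tangent (h : IsExponentialField exp) (hmax : AttainsMax exp) (h_one : exp 1 = 2) :
    ∃ c r : R, 0 < c ∧ 0 < r ∧ ∀ x, |x| ≤ r → 1 + c * x ≤ exp x := by
  have hf : IsExpFun exp (fun x => x + -1 * exp x) :=
    (IsExpFun.id.add ((IsExpFun.const (-1)).mul (.exp .id))).congr fun x => rfl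
  obtain ⟨m, ⟨hm0, hm1⟩, hm⟩ := hmax _ hf 0 1 zero_le_one
  -- Both ends of `[0, 1]` give the value `-1`; the midpoint gives more because `√2 < 3/2`, so the
  -- maximum is interior.
  have hhalf : exp (1 / 2) ^ 2 = 2 := by
    rw [sq, ← h.map_add, add_halves, h_one]
  have hlt : exp (1 / 2) < 3 / 2 := by nlinarith [h.pos (1 / 2)]
  have h2 := hm (1 / 2) ⟨by norm_num, by norm_num⟩
  have hm0' : m ≠ 0 := by
    rintro rfl
    rw [h.map_zero] at h2
    linarith
  have hm1' : m ≠ 1 := by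
    rintro rfl
    rw [h_one] at h2
    linarith
  have hm0 : 0 < m := lt_of_le_of_ne hm0 hm0'.symm
  have hm1 : m < 1 := lt_of_le_of_ne hm1 hm1'
  refine ⟨exp (-m), min m (1 - m), h.pos _, lt_min hm0 (by linarith), fun x hx => ?_⟩
  obtain ⟨hx1, hx2⟩ := abs_le.1 hx
  have h3 := hm (m + x) ⟨by linarith [min_le_left m (1 - m)], by linarith [min_le_right m (1 - m)]⟩
  simp only [h.map_add] at h3
  have h4 := h.map_mul_map_neg m
  have h5 := mul_le_mul_of_nonneg_right h3 (h.pos (-m)).le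
  linear_combination h5 + (exp x - 1) * h4

/-- The tangent inequality at `-x` gives `exp x * (1 - c x) ≤ 1`, an upper bound matching the lower
one at `x` up to `2 c² x²` when `|c x| ≤ 1/2`. The functional equation carries this from `0` to any
point. For increments longer than `s` the remainder is merely bounded, by `B ≤ B / s² * (w - z)²`.
-/
theorem exists_hasUniformDeriv (h : IsExponentialField exp) (hmax : AttainsMax exp)
    (h_one : exp 1 = 2) : ∃ c : R, HasUniformDeriv exp (fun x => c * exp x) := by
  obtain ⟨c, r, hc, hr, htan⟩ := h.exists_tangent hmax h_one
  refine ⟨c, fun p q => ?_⟩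
  set s := min r (1 / (2 * c)) with hs
  have hs0 : 0 < s := lt_min hr (by positivity)
  have hsr : s ≤ r := min_le_left _ _
  have hsc : c * s ≤ 1 / 2 := by
    calc c * s ≤ c * (1 / (2 * c)) := by gcongr; exact min_le_right _ _
      _ = _ := by field_simp
  have small : ∀ x, |x| ≤ s → 0 ≤ exp x - 1 - c * x ∧ exp x - 1 - c * x ≤ 2 * c ^ 2 * x ^ 2 := by
    intro x hx
    have h1 := htan x (hx.trans hsr)
    have h2 := htan (-x) (by rw [abs_neg]; exact hx.trans hsr)
    have h3 := h.map_mul_map_neg x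
    have h4 : |c * x| ≤ 1 / 2 := by
      rw [abs_mul, abs_of_pos hc]
      exact (mul_le_mul_of_nonneg_left hx hc.le).trans hsc
    obtain ⟨h5, h6⟩ := abs_le.1 h4
    refine ⟨by linarith, ?_⟩
    have h7 : exp x * (1 - c * x) ≤ 1 := by
      rw [← h3]
      exact mul_le_mul_of_nonneg_left (by linarith) (h.pos x).le
    nlinarith [sq_nonneg (c * x)]
  set E := exp q with hE
  have hE0 : 0 < E := h.pos _
  have hle : ∀ z ∈ Set.Icc p q, exp z ≤ E := fun z hz => h.strictMono.monotone hz.2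
  set B := 2 * E + c * E * |q - p| with hB
  have hB0 : 0 < B := by positivity
  set K := E * (2 * c ^ 2) + B / s ^ 2 with hK
  have hK0 : 0 < K := by positivity
  have hquad : ∀ z ∈ Set.Icc p q, ∀ w ∈ Set.Icc p q,
      |exp w - exp z - c * exp z * (w - z)| ≤ K * (w - z) ^ 2 := by
    intro z hz w hw
    by_cases hx : |w - z| ≤ s
    · obtain ⟨h1, h2⟩ := small _ hx
      have h3 : exp w = exp z * exp (w - z) := by rw [← h.map_add]; congr 1; ring
      have h4 : exp w - exp z - c * exp z * (w - z)
          = exp z * (exp (w - z) - 1 - c * (w - z)) := by rw [h3]; ring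
      rw [h4, abs_mul, abs_of_pos (h.pos z), abs_of_nonneg h1]
      calc _ ≤ E * (2 * c ^ 2 * (w - z) ^ 2) := mul_le_mul (hle z hz) h2 h1 hE0.le
        _ = E * (2 * c ^ 2) * (w - z) ^ 2 := by ring
        _ ≤ _ := by
          have : 0 < B / s ^ 2 := by positivity
          exact mul_le_mul_of_nonneg_right (by linarith) (sq_nonneg _)
    · push Not at hx
      have h1 : |w - z| ≤ |q - p| := by
        rw [abs_of_nonneg (by linarith [hz.1, hz.2] : 0 ≤ q - p), abs_le]
        constructor <;> linarith [hz.1, hz.2, hw.1, hw.2]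
      have h2 : |exp w - exp z - c * exp z * (w - z)| ≤ B := by
        refine (abs_sub _ _).trans ?_
        refine add_le_add ((abs_sub _ _).trans ?_) ?_
        · rw [abs_of_pos (h.pos w), abs_of_pos (h.pos z)]
          linarith [hle z hz, hle w hw]
        · rw [abs_mul, abs_mul, abs_of_pos hc, abs_of_pos (h.pos z)]
          have := hle z hz
          gcongr
      have h3 : s ^ 2 ≤ (w - z) ^ 2 := by
        rw [← sq_abs (w - z)]; gcongr
      calc _ ≤ B := h2
        _ = B / s ^ 2 * s ^ 2 := by field_simp
        _ ≤ B / s ^ 2 * (w - z) ^ 2 := by gcongr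
        _ ≤ _ := mul_le_mul_of_nonneg_right (by
          have : 0 < E * (2 * c ^ 2) := by positivity
          linarith) (sq_nonneg _)
  refine ⟨E + c * E + K * |q - p| + K, by positivity, fun z hz => ⟨?_, ?_, fun w hw => ⟨?_, ?_⟩⟩⟩
  · rw [abs_of_pos (h.pos z)]
    have : 0 ≤ c * E + K * |q - p| + K := by positivity
    linarith [hle z hz]
  · rw [abs_mul, abs_of_pos hc, abs_of_pos (h.pos z)]
    have : 0 ≤ E + K * |q - p| + K := by positivity
    linarith [mul_le_mul_of_nonneg_left (hle z hz) hc.le]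
  · have h1 : |w - z| ≤ |q - p| := by
      rw [abs_of_nonneg (by linarith [hz.1, hz.2] : 0 ≤ q - p), abs_le]
      constructor <;> linarith [hz.1, hz.2, hw.1, hw.2]
    have h2 := hquad z hz w hw
    rw [← sq_abs] at h2
    have h3 : |exp w - exp z| ≤ |exp w - exp z - c * exp z * (w - z)| + |c * exp z * (w - z)| := by
      refine le_trans (le_of_eq ?_) (abs_add_le _ _)
      congr 1; ring
    have h4 : |c * exp z * (w - z)| ≤ c * E * |w - z| := by
      rw [abs_mul, abs_mul, abs_of_pos hc, abs_of_pos (h.pos z)]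
      have := hle z hz
      gcongr
    have h5 : K * |w - z| ^ 2 ≤ K * |q - p| * |w - z| := by
      rw [sq, mul_assoc]
      gcongr
    have h6 : 0 ≤ E * |w - z| := by positivity
    have h7 : 0 ≤ K * |w - z| := by positivity
    linarith
  · refine (hquad z hz w hw).trans (mul_le_mul_of_nonneg_right ?_ (sq_nonneg _))
    have : 0 ≤ E + c * E + K * |q - p| := by positivity
    linarith

end IsExponentialField

theorem IsExpFun.exists_hasUniformDeriv {exp : R → R} {c : R}
    (hc : HasUniformDeriv exp (fun x => c * exp x)) {f : R → R} (hf : IsExpFun exp f) :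
    ∃ f', HasUniformDeriv f f' ∧ IsExpFun exp f' := by
  induction hf with
  | const a => exact ⟨_, .const a, .const 0⟩
  | id => exact ⟨_, .id, .const 1⟩
  | add _ _ ihf ihg =>
    obtain ⟨f', hf, hf'⟩ := ihf
    obtain ⟨g', hg, hg'⟩ := ihg
    exact ⟨_, hf.add hg, hf'.add hg'⟩
  | mul h1 h2 ihf ihg =>
    obtain ⟨f', hf, hf'⟩ := ihf
    obtain ⟨g', hg, hg'⟩ := ihg
    exact ⟨_, hf.mul hg, (hf'.mul h2).add (h1.mul hg')⟩
  | exp h1 ih =>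
    obtain ⟨f', hf, hf'⟩ := ih
    exact ⟨_, hc.comp hf, ((IsExpFun.const c).mul h1.exp).mul hf'⟩

end ExpFun

/-! ### Constancy of sign and Wronskians -/

section Zeros

variable {R : Type*} [Field R] [LinearOrder R] [IsStrictOrderedRing R] {exp : R → R}

/-- A function of the class that has no zero on a segment is bounded away from zero there. -/
theorem AttainsMax.exists_le_abs (hmax : AttainsMax exp) {f : R → R} (hf : IsExpFun exp f)
    {p q : R} (hpq : p ≤ q) (h0 : ∀ z ∈ Set.Icc p q, f z ≠ 0) :
    ∃ μ : R, 0 < μ ∧ ∀ z ∈ Set.Icc p q, μ ≤ |f z| := by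
  -- A maximum of `-f²` is a minimum of `|f|`, which itself need not be in the class.
  obtain ⟨m, hm, hmz⟩ := hmax _ (hf.mul hf).neg p q hpq
  refine ⟨|f m|, abs_pos.2 (h0 m hm), fun z hz => ?_⟩
  have := hmz z hz
  simp only [Pi.neg_apply, Pi.mul_apply, neg_le_neg_iff] at this
  exact sq_le_sq.1 (by rw [sq, sq]; exact this)

variable {c : R}

/-- The values of `f` avoid `(-μ, μ)`, and by the Lipschitz bound a step of length at most `2 * δ`
changes `f` by at most `μ / 2`, so no step can jump the gap. -/
theorem IsExponentialField.pos_of_ne_zero (h : IsExponentialField exp) (hmax : AttainsMax exp)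
    (hc : HasUniformDeriv exp (fun x => c * exp x)) {f : R → R} (hf : IsExpFun exp f)
    {p q : R} (hpq : p ≤ q) (h0 : ∀ z ∈ Set.Icc p q, f z ≠ 0) (hp : 0 < f p) : 0 < f q := by
  rcases hpq.eq_or_lt with rfl | hpq
  · exact hp
  obtain ⟨μ, hμ, hfμ⟩ := hmax.exists_le_abs hf hpq.le h0
  obtain ⟨f', hf', -⟩ := hf.exists_hasUniformDeriv hc
  obtain ⟨K, hK, hfK⟩ := hf' p q
  set δ := min (q - p) (μ / (4 * K)) with hδ
  have hδ0 : 0 < δ := lt_min (by linarith) (by positivity)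
  have hδp : δ ≤ q - p := min_le_left _ _
  have hδK : K * (2 * δ) ≤ μ / 2 := by
    calc K * (2 * δ) ≤ K * (2 * (μ / (4 * K))) := by gcongr; exact min_le_right _ _
      _ = μ / 2 := by field_simp; norm_num
  have := h.le_of_uniform_step hmax hf (u := p) (v := q) (half_pos hμ) hδ0 (by linarith)
    (by linarith) ?_
  · linarith
  intro z w hz hw hzw hwz hfz
  have hzm : z ∈ Set.Icc p q := ⟨hz, by linarith⟩
  have hwm : w ∈ Set.Icc p q := ⟨by linarith, hw⟩
  have h1 : μ ≤ f z := by
    rcases le_abs.1 (hfμ z hzm) with h1 | h1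
    · exact h1
    · linarith
  have h2 := (abs_le.1 ((hfK z hzm).2.2 w hwm).1).1
  rw [abs_of_nonneg (by linarith : 0 ≤ w - z)] at h2
  have h3 : K * (w - z) ≤ K * (2 * δ) := by gcongr; linarith
  linarith

/-- A function of the class that has no zero on a segment has constant sign there. -/
theorem IsExponentialField.pos_or_neg (h : IsExponentialField exp) (hmax : AttainsMax exp)
    (hc : HasUniformDeriv exp (fun x => c * exp x)) {f : R → R} (hf : IsExpFun exp f)
    {p q : R} (h0 : ∀ z ∈ Set.Icc p q, f z ≠ 0) :
    (∀ z ∈ Set.Icc p q, 0 < f z) ∨ (∀ z ∈ Set.Icc p q, f z < 0) := by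
  by_cases hpq : p ≤ q
  swap
  · exact .inl fun z hz => absurd (hz.1.trans hz.2) hpq
  have hsub : ∀ z ∈ Set.Icc p q, ∀ x ∈ Set.Icc p z, f x ≠ 0 := fun z hz x hx =>
    h0 x ⟨hx.1, hx.2.trans hz.2⟩
  rcases (h0 p ⟨le_rfl, hpq⟩).lt_or_gt with hp | hp
  · right
    intro z hz
    have := h.pos_of_ne_zero hmax hc hf.neg hz.1
      (fun x hx => neg_ne_zero.2 (hsub z hz x hx)) (neg_pos.2 hp)
    exact neg_pos.1 this
  · exact .inl fun z hz => h.pos_of_ne_zero hmax hc hf hz.1 (hsub z hz) hp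

/-- A function whose Wronskian with a positive function is positive is positive to the right of
each of its zeros. -/
theorem IsExponentialField.pos_of_wronskian_pos (h : IsExponentialField exp)
    (hmax : AttainsMax exp) {f f' a a' : R → R}
    (hf : IsExpFun exp f) (hf' : IsExpFun exp f') (ha : IsExpFun exp a) (ha' : IsExpFun exp a')
    (hff : HasUniformDeriv f f') (haa : HasUniformDeriv a a')
    {p q : R} (hpq : p < q) (hapos : ∀ z ∈ Set.Icc p q, 0 < a z)
    (hW : ∀ z ∈ Set.Icc p q, 0 < f' z * a z - f z * a' z) (hp : f p = 0) : 0 < f q := by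
  obtain ⟨ω, hω, hWω⟩ := hmax.exists_le_abs ((hf'.mul ha).sub (hf.mul ha')) hpq.le
    (fun z hz => (hW z hz).ne')
  obtain ⟨A, hA, haA⟩ := haa p q
  obtain ⟨K, hK, hfK⟩ := hff p q
  -- Where `|f| ≤ η`, the term `f * a'` uses at most half of the lower bound `ω` of the Wronskian;
  -- the other half forces `f' ≥ η`.
  set η := ω / (2 * A) with hη
  have hη0 : 0 < η := by positivity
  have hderiv : ∀ z ∈ Set.Icc p q, |f z| ≤ η → η ≤ f' z := by
    intro z hz hfz
    have h1 := hWω z hz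
    simp only [Pi.sub_apply, Pi.mul_apply] at h1
    rw [abs_of_pos (hW z hz)] at h1
    have h2 : |f z * a' z| ≤ η * A := by
      rw [abs_mul]
      exact mul_le_mul hfz (haA z hz).2.1 (abs_nonneg _) hη0.le
    have h3 : η * A = ω / 2 := by rw [hη]; field_simp
    have h4 := (abs_le.1 h2).1
    have h5 : η * A ≤ f' z * a z := by linarith
    have h6 : 0 < f' z := by
      refine pos_of_mul_pos_left (lt_of_lt_of_le (by positivity) h5) (hapos z hz).le
    have h7 : f' z * a z ≤ f' z * A :=
      mul_le_mul_of_nonneg_left ((le_abs_self _).trans (haA z hz).1) h6.le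
    exact le_of_mul_le_mul_right (h5.trans h7) hA
  set δ := min (q - p) (η / (4 * K)) with hδ
  have hδ0 : 0 < δ := lt_min (by linarith) (by positivity)
  have hδp : δ ≤ q - p := min_le_left _ _
  have hδK : K * (2 * δ) ≤ η / 2 := by
    calc K * (2 * δ) ≤ K * (2 * (η / (4 * K))) := by gcongr; exact min_le_right _ _
      _ = η / 2 := by field_simp; norm_num
  -- If `f z ≥ η`, a step loses at most `η / 2`. Otherwise `f' z ≥ η`, the remainder eats at most
  -- half of the growth, and the gain `η * δ / 2` lifts `-θ` to `θ`.
  set θ := min (η / 2) (η * δ / 4) with hθ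
  have hθ0 : 0 < θ := by positivity
  have hθ1 : θ ≤ η / 2 := min_le_left _ _
  have hθ2 : θ ≤ η * δ / 4 := min_le_right _ _
  have := h.le_of_uniform_step hmax hf (u := p) (v := q) hθ0 hδ0 (by linarith)
    (by linarith) ?_
  · linarith
  intro z w hz hw hzw hwz hfz
  have hzm : z ∈ Set.Icc p q := ⟨hz, by linarith⟩
  have hwm : w ∈ Set.Icc p q := ⟨by linarith, hw⟩
  obtain ⟨h1, h2⟩ := (hfK z hzm).2.2 w hwm
  have h3 : K * (w - z) ≤ K * (2 * δ) := by gcongr; linarith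
  by_cases hlarge : η ≤ f z
  · have h4 := (abs_le.1 h1).1
    rw [abs_of_nonneg (by linarith : 0 ≤ w - z)] at h4
    linarith
  · push Not at hlarge
    have h4 := hderiv z hzm (abs_le.2 ⟨by linarith, hlarge.le⟩)
    have h5 := (abs_le.1 h2).1
    have h6 : η * (w - z) ≤ f' z * (w - z) := mul_le_mul_of_nonneg_right h4 (by linarith)
    have h7 : K * (w - z) ^ 2 ≤ η / 2 * (w - z) := by
      rw [sq, ← mul_assoc]
      exact mul_le_mul_of_nonneg_right (h3.trans hδK) (by linarith)
    have h8 : η / 2 * δ ≤ η / 2 * (w - z) := mul_le_mul_of_nonneg_left (by linarith) (by linarith)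
    linarith

/-- If `a` and the Wronskian of `f` and `a` have no zero on a segment, then `f` has at most one
zero there. -/
theorem IsExponentialField.ne_zero_of_wronskian_ne_zero (h : IsExponentialField exp)
    (hmax : AttainsMax exp) (hc : HasUniformDeriv exp (fun x => c * exp x)) {f f' a a' : R → R}
    (hf : IsExpFun exp f) (hf' : IsExpFun exp f') (ha : IsExpFun exp a) (ha' : IsExpFun exp a')
    (hff : HasUniformDeriv f f') (haa : HasUniformDeriv a a')
    {p q : R} (hpq : p < q) (ha0 : ∀ z ∈ Set.Icc p q, a z ≠ 0)
    (hW : ∀ z ∈ Set.Icc p q, f' z * a z - f z * a' z ≠ 0) (hp : f p = 0) : f q ≠ 0 := by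
  rcases h.pos_or_neg hmax hc ha ha0 with ha1 | ha1 <;>
  rcases h.pos_or_neg hmax hc ((hf'.mul ha).sub (hf.mul ha')) hW with hW1 | hW1
  · exact (h.pos_of_wronskian_pos hmax hf hf' ha ha' hff haa hpq ha1 hW1 hp).ne'
  · have := h.pos_of_wronskian_pos hmax hf.neg hf'.neg ha ha' hff.neg haa hpq ha1
      (fun z hz => by
        have := hW1 z hz
        simp only [Pi.sub_apply, Pi.mul_apply, Pi.neg_apply] at this ⊢
        linarith) (by simp [hp])
    exact (neg_pos.1 this).ne
  · have := h.pos_of_wronskian_pos hmax hf.neg hf'.neg ha.neg ha'.neg hff.neg haa.neg hpq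
      (fun z hz => neg_pos.2 (ha1 z hz))
      (fun z hz => by
        have := hW1 z hz
        simp only [Pi.sub_apply, Pi.mul_apply, Pi.neg_apply] at this ⊢
        linarith) (by simp [hp])
    exact (neg_pos.1 this).ne
  · exact (h.pos_of_wronskian_pos hmax hf hf' ha.neg ha'.neg hff haa.neg hpq
      (fun z hz => neg_pos.2 (ha1 z hz))
      (fun z hz => by
        have := hW1 z hz
        simp only [Pi.sub_apply, Pi.mul_apply, Pi.neg_apply] at this ⊢
        linarith) hp).ne'

/-- Adding `ε * (x - p) * a` makes the Wronskian `ε * a² > 0`. If `f q < 0`, some `ε > 0` makes the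
perturbed function vanish at `q`, where it should be positive. -/
theorem IsExponentialField.nonneg_of_wronskian_eq_zero (h : IsExponentialField exp)
    (hmax : AttainsMax exp) {f f' a a' : R → R}
    (hf : IsExpFun exp f) (hf' : IsExpFun exp f') (ha : IsExpFun exp a) (ha' : IsExpFun exp a')
    (hff : HasUniformDeriv f f') (haa : HasUniformDeriv a a')
    {p q : R} (hpq : p < q) (ha0 : ∀ z ∈ Set.Icc p q, 0 < a z)
    (hW : ∀ z ∈ Set.Icc p q, f' z * a z - f z * a' z = 0) (hp : f p = 0) : 0 ≤ f q := by
  by_contra hq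
  push Not at hq
  have haq : 0 < a q := ha0 q ⟨hpq.le, le_rfl⟩
  have hqp : 0 < q - p := by linarith
  set ε := -f q / ((q - p) * a q) with hε
  have hε0 : 0 < ε := div_pos (by linarith) (by positivity)
  have hεq : ε * ((q - p) * a q) = -f q := by rw [hε]; field_simp
  have hl : IsExpFun exp (fun x => ε * (x + -p)) :=
    ((IsExpFun.const ε).mul (IsExpFun.id.add (.const (-p)))).congr fun x => rfl
  have hl' : HasUniformDeriv (fun x => ε * (x + -p)) (fun _ => ε) :=
    ((HasUniformDeriv.const ε).mul (HasUniformDeriv.id.add (.const (-p)))).congr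
      (fun x => rfl) (fun x => by simp)
  have := h.pos_of_wronskian_pos hmax (hf.add (hl.mul ha))
    (hf'.add (((IsExpFun.const ε).mul ha).add (hl.mul ha'))) ha ha' (hff.add (hl'.mul haa)) haa
    hpq ha0 (fun z hz => by
      have h1 := hW z hz
      have h2 : 0 < ε * (a z * a z) := mul_pos hε0 (mul_pos (ha0 z hz) (ha0 z hz))
      simp only [Pi.add_apply, Pi.mul_apply]
      linear_combination h2 - h1) (by simp [hp])
  simp only [Pi.add_apply, Pi.mul_apply] at this
  linarith

/-- If the Wronskian of `f` and a nonvanishing function is zero on a segment, then `f` vanishes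
at the right end if it vanishes at the left end. -/
theorem IsExponentialField.eq_zero_of_wronskian_eq_zero (h : IsExponentialField exp)
    (hmax : AttainsMax exp) (hc : HasUniformDeriv exp (fun x => c * exp x)) {f f' a a' : R → R}
    (hf : IsExpFun exp f) (hf' : IsExpFun exp f') (ha : IsExpFun exp a) (ha' : IsExpFun exp a')
    (hff : HasUniformDeriv f f') (haa : HasUniformDeriv a a')
    {p q : R} (hpq : p < q) (ha0 : ∀ z ∈ Set.Icc p q, a z ≠ 0)
    (hW : ∀ z ∈ Set.Icc p q, f' z * a z - f z * a' z = 0) : f p = 0 → f q = 0 := by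
  intro hp
  have hWn : ∀ z ∈ Set.Icc p q, (-f') z * a z - (-f) z * a' z = 0 := fun z hz => by
    simp only [Pi.neg_apply]
    linear_combination -hW z hz
  rcases h.pos_or_neg hmax hc ha ha0 with ha1 | ha1
  · have h1 := h.nonneg_of_wronskian_eq_zero hmax hf hf' ha ha' hff haa hpq ha1 hW hp
    have h2 := h.nonneg_of_wronskian_eq_zero hmax hf.neg hf'.neg ha ha' hff.neg haa hpq ha1
      hWn (by simp [hp])
    exact le_antisymm (neg_nonneg.1 h2) h1
  · have ha2 : ∀ z ∈ Set.Icc p q, 0 < (-a) z := fun z hz => neg_pos.2 (ha1 z hz)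
    have h1 := h.nonneg_of_wronskian_eq_zero hmax hf hf' ha.neg ha'.neg hff haa.neg hpq ha2
      (fun z hz => by
        simp only [Pi.neg_apply]
        linear_combination -hW z hz) hp
    have h2 := h.nonneg_of_wronskian_eq_zero hmax hf.neg hf'.neg ha.neg ha'.neg hff.neg haa.neg
      hpq ha2 (fun z hz => by
        simp only [Pi.neg_apply]
        linear_combination hW z hz) (by simp [hp])
    exact le_antisymm (neg_nonneg.1 h2) h1

/-- The leftward version comes from the rightward one applied to `a(p) * f - f(p) * a`, which
vanishes at `p`. -/
theorem IsExponentialField.eq_zero_of_wronskian_eq_zero' (h : IsExponentialField exp)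
    (hmax : AttainsMax exp) (hc : HasUniformDeriv exp (fun x => c * exp x)) {f f' a a' : R → R}
    (hf : IsExpFun exp f) (hf' : IsExpFun exp f') (ha : IsExpFun exp a) (ha' : IsExpFun exp a')
    (hff : HasUniformDeriv f f') (haa : HasUniformDeriv a a')
    {p q : R} (hpq : p < q) (ha0 : ∀ z ∈ Set.Icc p q, a z ≠ 0)
    (hW : ∀ z ∈ Set.Icc p q, f' z * a z - f z * a' z = 0) (hq : f q = 0) : f p = 0 := by
  have key := h.eq_zero_of_wronskian_eq_zero hmax hc
    (((IsExpFun.const (a p)).mul hf).add ((IsExpFun.const (-f p)).mul ha))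
    (((IsExpFun.const (a p)).mul hf').add ((IsExpFun.const (-f p)).mul ha')) ha ha'
    ((((HasUniformDeriv.const (a p)).mul hff).add ((HasUniformDeriv.const (-f p)).mul haa)).congr
      (fun x => rfl) (fun x => by simp)) haa hpq ha0
    (fun z hz => by
      simp only [Pi.add_apply, Pi.mul_apply]
      linear_combination a p * hW z hz) (by
      simp only [Pi.add_apply, Pi.mul_apply]
      ring)
  simp only [Pi.add_apply, Pi.mul_apply, hq, mul_zero, zero_add] at key
  rcases mul_eq_zero.1 key with h1 | h1
  · exact neg_eq_zero.1 h1
  · exact absurd h1 (ha0 q ⟨hpq.le, le_rfl⟩)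

end Zeros

/-! ### Finiteness of zeros by induction along exponential towers -/

section Towers

variable {R : Type*} [Field R] [LinearOrder R] [IsStrictOrderedRing R] {exp : R → R}

/-- Off a finite set, `f` locally either vanishes identically or has no zero. -/
def IsPiecewiseZero (f : R → R) : Prop :=
  ∃ S : Finset R, ∀ p q, Disjoint (Set.Icc p q) ↑S →
    (∀ z ∈ Set.Icc p q, f z = 0) ∨ (∀ z ∈ Set.Icc p q, f z ≠ 0)

theorem isPiecewiseZero_of_finite {f : R → R} (hf : {x | f x = 0}.Finite) : IsPiecewiseZero f :=
  ⟨hf.toFinset, fun _ _ h => .inr fun z hz h0 =>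
    Set.disjoint_left.1 h hz (by simpa using h0)⟩

theorem isPiecewiseZero_polynomial (P : Polynomial R) : IsPiecewiseZero (fun x => P.eval x) := by
  by_cases hP : P = 0
  · exact ⟨∅, fun p q _ => .inl fun z _ => by simp [hP]⟩
  · refine isPiecewiseZero_of_finite (P.roots.toFinset.finite_toSet.subset fun x hx => ?_)
    simpa [hP] using hx

/-- It is enough to bound the number of isolated zeros between consecutive points of a
finite set. -/
theorem isPiecewiseZero_of_subsingleton {f : R → R} (S : Finset R)
    (hS : ∀ p q, Disjoint (Set.Icc p q) (S : Set R) → (∀ z ∈ Set.Icc p q, f z = 0) ∨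
      ∀ z ∈ Set.Icc p q, ∀ w ∈ Set.Icc p q, z < w → f z = 0 → f w ≠ 0) : IsPiecewiseZero f := by
  classical
  set Z : Set R := {z | f z = 0 ∧ ∃ p q, z ∈ Set.Icc p q ∧ Disjoint (Set.Icc p q) (S : Set R) ∧
    ∃ y ∈ Set.Icc p q, f y ≠ 0} with hZ
  -- If no point of `S` separates `z` from `z'`, one segment free of `S` contains both zeros and a
  -- point where `f` is nonzero. Hence `Z` injects into the subsets of `S`.
  have key : ∀ z ∈ Z, ∀ z' ∈ Z, z < z' → S.filter (· ≤ z) ≠ S.filter (· ≤ z') := by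
    rintro z ⟨hz, p, q, hzp, hd, y, hy, hfy⟩ z' ⟨hz', p', q', hzp', hd', -⟩ hlt heq
    have hmid : Disjoint (Set.Icc z z') (S : Set R) := by
      rw [Set.disjoint_left]
      intro x hx hxS
      have h1 : x ∈ S.filter (· ≤ z') := Finset.mem_filter.2 ⟨hxS, hx.2⟩
      rw [← heq] at h1
      have h2 : x = z := le_antisymm (Finset.mem_filter.1 h1).2 hx.1
      exact Set.disjoint_left.1 hd (h2 ▸ hzp) hxS
    have hall : Disjoint (Set.Icc (min p z) (max q z')) (S : Set R) := by
      rw [Set.disjoint_left]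
      intro x hx hxS
      rw [min_eq_left hzp.1] at hx
      by_cases h1 : x ≤ q
      · exact Set.disjoint_left.1 hd ⟨hx.1, h1⟩ hxS
      · push Not at h1
        have h2 : x ≤ z' := (le_max_iff.1 hx.2).resolve_left (not_le.2 h1)
        exact Set.disjoint_left.1 hmid ⟨hzp.2.trans h1.le, h2⟩ hxS
    have hzm : z ∈ Set.Icc (min p z) (max q z') := ⟨min_le_right _ _, hlt.le.trans (le_max_right _ _)⟩
    have hzm' : z' ∈ Set.Icc (min p z) (max q z') :=
      ⟨(min_le_right _ _).trans hlt.le, le_max_right _ _⟩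
    have hym : y ∈ Set.Icc (min p z) (max q z') :=
      ⟨(min_le_left _ _).trans hy.1, hy.2.trans (le_max_left _ _)⟩
    rcases hS _ _ hall with h1 | h1
    · exact hfy (h1 y hym)
    · exact h1 z hzm z' hzm' hlt hz hz'
  have hZfin : Z.Finite := by
    refine Set.Finite.of_finite_image (f := fun z => S.filter (· ≤ z))
      (S.powerset.finite_toSet.subset ?_) ?_
    · rintro _ ⟨z, -, rfl⟩
      exact Finset.mem_coe.2 (Finset.mem_powerset.2 (Finset.filter_subset _ _))
    · intro z hz z' hz' heq
      rcases lt_trichotomy z z' with h1 | h1 | h1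
      · exact absurd heq (key z hz z' hz' h1)
      · exact h1
      · exact absurd heq.symm (key z' hz' z hz h1)
  refine ⟨S ∪ hZfin.toFinset, fun p q hd => ?_⟩
  rw [Finset.coe_union, Set.disjoint_union_right] at hd
  by_contra hcon
  push Not at hcon
  obtain ⟨⟨y, hy, hfy⟩, z, hz, hfz⟩ := hcon
  exact Set.disjoint_left.1 hd.2 hz (by simpa using ⟨hfz, p, q, hz, hd.1, y, hy, hfy⟩)

/-- Polynomial expressions of degree at most `n` in `e` with coefficients in `A`. -/
def polyIn (A : Subalgebra R (R → R)) (e : R → R) : ℕ → Set (R → R)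
  | 0 => A
  | n + 1 => {f | ∃ a ∈ A, ∃ g ∈ polyIn A e n, f = a + e * g}

namespace polyIn

variable {A : Subalgebra R (R → R)} {e : R → R}

theorem zero_mem (n : ℕ) : 0 ∈ polyIn A e n := by
  induction n with
  | zero => exact A.zero_mem
  | succ n ih => exact ⟨0, A.zero_mem, 0, ih, by simp⟩

theorem add_mem {n : ℕ} {f g : R → R} (hf : f ∈ polyIn A e n) (hg : g ∈ polyIn A e n) :
    f + g ∈ polyIn A e n := by
  induction n generalizing f g with
  | zero => exact A.add_mem hf hg
  | succ n ih =>
    obtain ⟨a, ha, f, hf, rfl⟩ := hf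
    obtain ⟨b, hb, g, hg, rfl⟩ := hg
    exact ⟨_, A.add_mem ha hb, _, ih hf hg, by ring⟩

theorem smul_mem {n : ℕ} {a f : R → R} (ha : a ∈ A) (hf : f ∈ polyIn A e n) :
    a * f ∈ polyIn A e n := by
  induction n generalizing f with
  | zero => exact A.mul_mem ha hf
  | succ n ih =>
    obtain ⟨b, hb, f, hf, rfl⟩ := hf
    exact ⟨_, A.mul_mem ha hb, _, ih hf, by ring⟩

theorem mono_succ {n : ℕ} : polyIn A e n ⊆ polyIn A e (n + 1) := by
  induction n with
  | zero => exact fun f hf => ⟨f, hf, 0, A.zero_mem, by simp⟩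
  | succ n ih =>
    rintro _ ⟨a, ha, g, hg, rfl⟩
    exact ⟨a, ha, g, ih hg, rfl⟩

theorem mono : Monotone (polyIn A e) := monotone_nat_of_le_succ fun _ => mono_succ

theorem mul_mem {m n : ℕ} {f g : R → R} (hf : f ∈ polyIn A e m) (hg : g ∈ polyIn A e n) :
    f * g ∈ polyIn A e (m + n) := by
  induction m generalizing f with
  | zero => exact mono (Nat.le_add_left n 0) (smul_mem hf hg)
  | succ m ih =>
    obtain ⟨a, ha, f, hf, rfl⟩ := hf
    rw [show (a + e * f) * g = a * g + (0 + e * (f * g)) by ring]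
    refine add_mem (mono (by omega) (smul_mem ha hg)) ?_
    rw [Nat.add_right_comm]
    exact ⟨0, A.zero_mem, _, ih hf, rfl⟩

theorem exists_of_mem_adjoin {f : R → R} (hf : f ∈ A ⊔ Algebra.adjoin R {e}) :
    ∃ n, f ∈ polyIn A e n := by
  rw [← Algebra.adjoin_eq A, ← Algebra.adjoin_union] at hf
  induction hf using Algebra.adjoin_induction with
  | mem x hx =>
    rcases hx with hx | hx
    · exact ⟨0, hx⟩
    · rw [Set.mem_singleton_iff] at hx
      exact ⟨1, 0, A.zero_mem, 1, A.one_mem, by rw [hx]; ring⟩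
  | algebraMap r => exact ⟨0, A.algebraMap_mem r⟩
  | add x y _ _ hx hy =>
    obtain ⟨m, hm⟩ := hx
    obtain ⟨n, hn⟩ := hy
    exact ⟨max m n, add_mem (mono (le_max_left _ _) hm) (mono (le_max_right _ _) hn)⟩
  | mul x y _ _ hx hy =>
    obtain ⟨m, hm⟩ := hx
    obtain ⟨n, hn⟩ := hy
    exact ⟨m + n, mul_mem hm hn⟩

theorem mem_sup {n : ℕ} {f : R → R} (hf : f ∈ polyIn A e n) : f ∈ A ⊔ Algebra.adjoin R {e} := by
  induction n generalizing f with
  | zero => exact (le_sup_left : A ≤ A ⊔ Algebra.adjoin R {e}) hf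
  | succ n ih =>
    obtain ⟨a, ha, g, hg, rfl⟩ := hf
    exact Subalgebra.add_mem _ ((le_sup_left : A ≤ A ⊔ Algebra.adjoin R {e}) ha)
      (Subalgebra.mul_mem _ ((le_sup_right : _ ≤ A ⊔ Algebra.adjoin R {e})
        (Algebra.subset_adjoin rfl)) (ih hg))

/-- Since `e' = d * e` with `d` in `A`, differentiation does not raise the degree in `e`. -/
theorem exists_hasUniformDeriv {d : R → R} (hd : d ∈ A) (he : HasUniformDeriv e (d * e))
    (hA : ∀ f ∈ A, ∃ f' ∈ A, HasUniformDeriv f f') {n : ℕ} {f : R → R} (hf : f ∈ polyIn A e n) :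
    ∃ f' ∈ polyIn A e n, HasUniformDeriv f f' := by
  induction n generalizing f with
  | zero => exact hA f hf
  | succ n ih =>
    obtain ⟨a, ha, g, hg, rfl⟩ := hf
    obtain ⟨a', ha', haa⟩ := hA a ha
    obtain ⟨g', hg', hgg⟩ := ih hg
    refine ⟨_, ⟨a', ha', d * g + g', add_mem (smul_mem hd hg) hg', rfl⟩,
      (haa.add (he.mul hgg)).congr (fun _ => rfl) (fun x => ?_)⟩
    simp only [Pi.add_apply, Pi.mul_apply]
    ring

variable {c : R}

theorem isPiecewiseZero (h : IsExponentialField exp) (hmax : AttainsMax exp)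
    (hc : HasUniformDeriv exp (fun x => c * exp x)) (he0 : ∀ x, e x ≠ 0) {d : R → R} (hd : d ∈ A)
    (he : HasUniformDeriv e (d * e)) (hA : ∀ f ∈ A, ∃ f' ∈ A, HasUniformDeriv f f')
    (hAE : ∀ f ∈ A, IsExpFun exp f) (heE : IsExpFun exp e) (hAZ : ∀ f ∈ A, IsPiecewiseZero f)
    {n : ℕ} {f : R → R} (hf : f ∈ polyIn A e n) : IsPiecewiseZero f := by
  have hE : ∀ n, ∀ f ∈ polyIn A e n, IsExpFun exp f := by
    intro n
    induction n with
    | zero => exact hAE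
    | succ n ih =>
      rintro _ ⟨a, ha, g, hg, rfl⟩
      exact (hAE a ha).add (heE.mul (ih g hg))
  induction n generalizing f with
  | zero => exact hAZ f hf
  | succ n ih =>
    classical
    have hfE := hE _ f hf
    obtain ⟨a, ha, g, hg, rfl⟩ := hf
    obtain ⟨a', ha', haa⟩ := hA a ha
    obtain ⟨g', hg', hgg⟩ := exists_hasUniformDeriv hd he hA hg
    have hff : HasUniformDeriv (a + e * g) (a' + e * (d * g + g')) :=
      (haa.add (he.mul hgg)).congr (fun _ => rfl) (fun x => by
        simp only [Pi.add_apply, Pi.mul_apply]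
        ring)
    have hf'E : IsExpFun exp (a' + e * (d * g + g')) := (hAE a' ha').add
      (heE.mul (((hAE d hd).mul (hE n g hg)).add (hE n g' hg')))
    -- In the Wronskian of `a + e * g` and `a` the terms `a' * a` cancel and `e` factors out; the
    -- cofactor `V` has degree at most `n`.
    set V : R → R := (d * a) * g + a * g' + (-a') * g with hV
    have hVmem : V ∈ polyIn A e n :=
      add_mem (add_mem (smul_mem (A.mul_mem hd ha) hg) (smul_mem ha hg'))
        (smul_mem (A.neg_mem ha') hg)
    have hW : ∀ z, (a' + e * (d * g + g')) z * a z - (a + e * g) z * a' z = e z * V z := by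
      intro z
      simp only [hV, Pi.add_apply, Pi.mul_apply, Pi.neg_apply]
      ring
    obtain ⟨S₁, hS₁⟩ := hAZ a ha
    obtain ⟨S₂, hS₂⟩ := ih hg
    obtain ⟨S₃, hS₃⟩ := ih hVmem
    refine isPiecewiseZero_of_subsingleton (S₁ ∪ (S₂ ∪ S₃)) fun p q hd => ?_
    simp only [Finset.coe_union, Set.disjoint_union_right] at hd
    obtain ⟨hd₁, hd₂, hd₃⟩ := hd
    rcases hS₁ p q hd₁ with h₁ | h₁
    · rcases hS₂ p q hd₂ with h₂ | h₂
      · exact .inl fun z hz => by simp [h₁ z hz, h₂ z hz]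
      · exact .inr fun z hz w hw _ _ => by simp [h₁ w hw, h₂ w hw, he0 w]
    · have hsub : ∀ {z w x}, z ∈ Set.Icc p q → w ∈ Set.Icc p q → x ∈ Set.Icc z w →
          x ∈ Set.Icc p q := fun hz hw hx => ⟨hz.1.trans hx.1, hx.2.trans hw.2⟩
      -- If `V` vanishes, `f / a` is constant and one zero forces all; otherwise `f / a` is strictly
      -- monotone.
      rcases hS₃ p q hd₃ with h₃ | h₃
      · by_cases hz : ∃ z ∈ Set.Icc p q, (a + e * g) z = 0
        · obtain ⟨z, hz, hfz⟩ := hz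
          refine .inl fun w hw => ?_
          rcases lt_trichotomy z w with hlt | rfl | hlt
          · exact h.eq_zero_of_wronskian_eq_zero hmax hc hfE hf'E (hAE a ha) (hAE a' ha') hff haa
              hlt (fun x hx => h₁ x (hsub hz hw hx))
              (fun x hx => by rw [hW, h₃ x (hsub hz hw hx), mul_zero]) hfz
          · exact hfz
          · exact h.eq_zero_of_wronskian_eq_zero' hmax hc hfE hf'E (hAE a ha) (hAE a' ha') hff haa
              hlt (fun x hx => h₁ x (hsub hw hz hx))
              (fun x hx => by rw [hW, h₃ x (hsub hw hz hx), mul_zero]) hfz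
        · push Not at hz
          exact .inr fun z _ w hw _ _ => hz w hw
      · refine .inr fun z hz w hw hlt hfz => ?_
        exact h.ne_zero_of_wronskian_ne_zero hmax hc hfE hf'E (hAE a ha) (hAE a' ha') hff haa
          hlt (fun x hx => h₁ x (hsub hz hw hx))
          (fun x hx => by rw [hW]; exact mul_ne_zero (he0 x) (h₃ x (hsub hz hw hx))) hfz

end polyIn

/-- The algebras of functions obtained from the polynomial functions by successively adjoining
`exp ∘ g` for functions `g` that are already present. -/
inductive IsExpTower (exp : R → R) : Subalgebra R (R → R) → Prop
  | base : IsExpTower exp (Algebra.adjoin R {fun x => x})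
  | step {A : Subalgebra R (R → R)} {g : R → R} : IsExpTower exp A → g ∈ A →
      IsExpTower exp (A ⊔ Algebra.adjoin R {fun x => exp (g x)})

namespace IsExpTower

variable {A B : Subalgebra R (R → R)}

theorem id_mem (hA : IsExpTower exp A) : (fun x => x) ∈ A := by
  induction hA with
  | base => exact Algebra.subset_adjoin rfl
  | step _ _ ih => exact (le_sup_left : _ ≤ _ ⊔ Algebra.adjoin R _) ih

/-- Towers are directed: the adjunctions that build `B` can be repeated on top of `A`. -/
theorem exists_le (hA : IsExpTower exp A) (hB : IsExpTower exp B) :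
    ∃ C, IsExpTower exp C ∧ A ≤ C ∧ B ≤ C := by
  induction hB with
  | base =>
    refine ⟨A, hA, le_rfl, Algebra.adjoin_le ?_⟩
    rintro _ rfl
    exact hA.id_mem
  | step _ hg ih =>
    obtain ⟨C, hC, hAC, hBC⟩ := ih
    exact ⟨_, hC.step (hBC hg), hAC.trans le_sup_left, sup_le_sup_right hBC _⟩

theorem exists_mem {f : R → R} (hf : IsExpFun exp f) : ∃ A, IsExpTower exp A ∧ f ∈ A := by
  induction hf with
  | const a => exact ⟨_, base, Subalgebra.algebraMap_mem _ a⟩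
  | id => exact ⟨_, base, base.id_mem (exp := exp)⟩
  | add _ _ ihf ihg =>
    obtain ⟨A, hA, hf⟩ := ihf
    obtain ⟨B, hB, hg⟩ := ihg
    obtain ⟨C, hC, hAC, hBC⟩ := hA.exists_le hB
    exact ⟨C, hC, add_mem (hAC hf) (hBC hg)⟩
  | mul _ _ ihf ihg =>
    obtain ⟨A, hA, hf⟩ := ihf
    obtain ⟨B, hB, hg⟩ := ihg
    obtain ⟨C, hC, hAC, hBC⟩ := hA.exists_le hB
    exact ⟨C, hC, mul_mem (hAC hf) (hBC hg)⟩
  | exp _ ih =>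
    obtain ⟨A, hA, hf⟩ := ih
    exact ⟨_, hA.step hf, (le_sup_right : _ ≤ A ⊔ _) (Algebra.subset_adjoin rfl)⟩

theorem isExpFun (hA : IsExpTower exp A) {f : R → R} (hf : f ∈ A) : IsExpFun exp f := by
  have adjoin : ∀ {s : Set (R → R)}, (∀ f ∈ s, IsExpFun exp f) → ∀ f ∈ Algebra.adjoin R s,
      IsExpFun exp f := by
    intro s hs f hf
    induction hf using Algebra.adjoin_induction with
    | mem x hx => exact hs x hx
    | algebraMap r => exact .const r
    | add x y _ _ hx hy => exact hx.add hy
    | mul x y _ _ hx hy => exact hx.mul hy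
  induction hA generalizing f with
  | base => exact adjoin (by rintro _ rfl; exact .id) f hf
  | @step A g _ hg ih =>
    rw [← Algebra.adjoin_eq A, ← Algebra.adjoin_union] at hf
    refine adjoin ?_ f hf
    rintro x (hx | rfl)
    · exact ih hx
    · exact (ih hg).exp

variable {c : R}

theorem exists_hasUniformDeriv (hc : HasUniformDeriv exp (fun x => c * exp x))
    (hA : IsExpTower exp A) {f : R → R} (hf : f ∈ A) : ∃ f' ∈ A, HasUniformDeriv f f' := by
  induction hA generalizing f with
  | base =>
    induction hf using Algebra.adjoin_induction with
    | mem x hx =>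
      rw [Set.mem_singleton_iff] at hx
      subst hx
      exact ⟨_, Subalgebra.algebraMap_mem _ 1, .id⟩
    | algebraMap r => exact ⟨_, Subalgebra.algebraMap_mem _ 0, .const r⟩
    | add x y _ _ hx hy =>
      obtain ⟨x', hx', hxx⟩ := hx
      obtain ⟨y', hy', hyy⟩ := hy
      exact ⟨_, add_mem hx' hy', hxx.add hyy⟩
    | mul x y hxm hym hx hy =>
      obtain ⟨x', hx', hxx⟩ := hx
      obtain ⟨y', hy', hyy⟩ := hy
      exact ⟨_, add_mem (mul_mem hx' hym) (mul_mem hxm hy'), hxx.mul hyy⟩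
  | @step A g _ hg ih =>
    obtain ⟨n, hn⟩ := polyIn.exists_of_mem_adjoin hf
    obtain ⟨g', hg', hgg⟩ := ih hg
    obtain ⟨f', hf', hff⟩ := polyIn.exists_hasUniformDeriv
      (d := (fun _ => c) * g') (mul_mem (A.algebraMap_mem c) hg')
      ((hc.comp hgg).congr (fun _ => rfl) (fun x => by simp only [Pi.mul_apply]; ring))
      (fun f hf => ih hf) hn
    exact ⟨f', polyIn.mem_sup hf', hff⟩

theorem isPiecewiseZero (h : IsExponentialField exp) (hmax : AttainsMax exp)
    (hc : HasUniformDeriv exp (fun x => c * exp x)) (hA : IsExpTower exp A) {f : R → R}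
    (hf : f ∈ A) : IsPiecewiseZero f := by
  induction hA generalizing f with
  | base =>
    rw [Algebra.adjoin_singleton_eq_range_aeval] at hf
    obtain ⟨P, rfl⟩ := hf
    convert isPiecewiseZero_polynomial P using 1
    funext x
    exact Polynomial.aeval_fn_apply P _ x
  | @step A g hA hg ih =>
    obtain ⟨n, hn⟩ := polyIn.exists_of_mem_adjoin hf
    obtain ⟨g', hg', hgg⟩ := hA.exists_hasUniformDeriv hc hg
    exact polyIn.isPiecewiseZero h hmax hc (fun x => (h.pos _).ne')
      (d := (fun _ => c) * g') (mul_mem (A.algebraMap_mem c) hg')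
      ((hc.comp hgg).congr (fun _ => rfl) (fun x => by simp only [Pi.mul_apply]; ring))
      (fun f hf => hA.exists_hasUniformDeriv hc hf) (fun f hf => hA.isExpFun hf)
      (hA.isExpFun hg).exp (fun f hf => ih hf) hn

end IsExpTower

/-- Off a finite set, the sign of a function of the class is locally constant. -/
theorem IsExponentialField.exists_sign_eq (h : IsExponentialField exp) (hmax : AttainsMax exp)
    (h_one : exp 1 = 2) {f : R → R} (hf : IsExpFun exp f) :
    ∃ S : Finset R, ∀ p q, p ≤ q → Disjoint (Set.Icc p q) ↑S →
      SignType.sign (f p) = SignType.sign (f q) := by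
  obtain ⟨c, hc⟩ := h.exists_hasUniformDeriv hmax h_one
  obtain ⟨A, hA, hfA⟩ := IsExpTower.exists_mem hf
  obtain ⟨S, hS⟩ := hA.isPiecewiseZero h hmax hc hfA
  refine ⟨S, fun p q hpq hd => ?_⟩
  have hp : p ∈ Set.Icc p q := ⟨le_rfl, hpq⟩
  have hq : q ∈ Set.Icc p q := ⟨hpq, le_rfl⟩
  rcases hS p q hd with h1 | h1
  · rw [h1 p hp, h1 q hq]
  · rcases h.pos_or_neg hmax hc hf h1 with h2 | h2
    · rw [sign_pos (h2 p hp), sign_pos (h2 q hq)]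
    · rw [sign_neg (h2 p hp), sign_neg (h2 q hq)]

end Towers

/-! ### Terms as functions; intermediate values and unions of intervals -/

section FieldSide

variable {R : Type*} [Field R] [LinearOrder R] [IsStrictOrderedRing R]

/-- A set is a finite union of points and open intervals if membership is locally constant off a
finite set. -/
theorem isFiniteUnionOfIntervals_of_forall_Icc {A : Set R} (S : Finset R)
    (hA : ∀ p q, p ≤ q → Disjoint (Set.Icc p q) ↑S → (p ∈ A ↔ q ∈ A)) :
    IsFiniteUnionOfIntervals A := by
  classical
  -- An empty component encodes an infinite endpoint.
  set G : Finset R × Finset R → Set R := fun T => {y | (∀ s ∈ T.1, s < y) ∧ ∀ s ∈ T.2, y < s}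
    with hG
  have hGint : ∀ T, IsPointOrInterval (G T) := by
    rintro ⟨T, U⟩
    have hT : T.Nonempty → ∃ a, ∀ y, (∀ s ∈ T, s < y) ↔ a < y := fun h =>
      ⟨T.max' h, fun y => (T.max'_lt_iff h).symm⟩
    have hU : U.Nonempty → ∃ b, ∀ y, (∀ s ∈ U, y < s) ↔ y < b := fun h =>
      ⟨U.min' h, fun y => (U.lt_min'_iff h).symm⟩
    rcases T.eq_empty_or_nonempty with rfl | hT' <;> rcases U.eq_empty_or_nonempty with rfl | hU'
    · exact .inr <| .inr <| .inr <| .inr <| by ext; simp [hG]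
    · obtain ⟨b, hb⟩ := hU hU'
      exact .inr <| .inr <| .inr <| .inl ⟨b, by ext; simp [hG, hb]⟩
    · obtain ⟨a, ha⟩ := hT hT'
      exact .inr <| .inr <| .inl ⟨a, by ext; simp [hG, ha]⟩
    · obtain ⟨a, ha⟩ := hT hT'
      obtain ⟨b, hb⟩ := hU hU'
      exact .inr <| .inl ⟨a, b, by ext; simp [hG, ha, hb]⟩
  refine ⟨(fun s => {s}) '' (↑S ∩ A) ∪ G '' (↑(S.powerset ×ˢ S.powerset) ∩ {T | G T ⊆ A}),
    ?_, ?_, ?_⟩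
  · exact ((S.finite_toSet.inter_of_left _).image _).union
      (((Finset.finite_toSet _).inter_of_left _).image _)
  · rintro _ (⟨s, -, rfl⟩ | ⟨T, -, rfl⟩)
    · exact .inl ⟨s, rfl⟩
    · exact hGint T
  · ext x
    rw [Set.mem_sUnion]
    constructor
    · intro hx
      by_cases hxS : x ∈ S
      · exact ⟨{x}, .inl ⟨x, ⟨hxS, hx⟩, rfl⟩, rfl⟩
      refine ⟨_, .inr ⟨(S.filter (· < x), S.filter (x < ·)), ⟨?_, ?_⟩, rfl⟩, ?_⟩
      · rw [Finset.mem_coe, Finset.mem_product, Finset.mem_powerset, Finset.mem_powerset]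
        exact ⟨Finset.filter_subset _ _, Finset.filter_subset _ _⟩
      · rintro y ⟨hy1, hy2⟩
        simp only [Finset.mem_filter, and_imp] at hy1 hy2
        rcases le_total x y with hxy | hxy
        · refine (hA x y hxy (Set.disjoint_left.2 fun s hs hsS => ?_)).1 hx
          have hne : x ≠ s := fun h => hxS (h ▸ hsS)
          exact not_lt.2 hs.2 (hy2 s hsS (lt_of_le_of_ne hs.1 hne))
        · refine (hA y x hxy (Set.disjoint_left.2 fun s hs hsS => ?_)).2 hx
          have hne : s ≠ x := fun h => hxS (h ▸ hsS)
          exact not_lt.2 hs.1 (hy1 s hsS (lt_of_le_of_ne hs.2 hne))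
      · exact ⟨fun s hs => (Finset.mem_filter.1 hs).2, fun s hs => (Finset.mem_filter.1 hs).2⟩
    · rintro ⟨_, ⟨s, hs, rfl⟩ | ⟨T, hT, rfl⟩, hx⟩
      · rw [Set.mem_singleton_iff.1 hx]
        exact hs.2
      · exact hT.2 hx

variable {exp : R → R}

theorem orderedStructure_orExp (exp : R → R) :
    letI := orExpStructure exp
    LOrExp.OrderedStructure R :=
  letI := orExpStructure exp
  ⟨fun _ => Iff.rfl⟩

theorem isExpFun_termValue {n : ℕ} (t : LOrExp.Term (Fin n ⊕ Unit)) (w : Fin n → R) :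
    IsExpFun exp (termValue exp t w) := by
  let := orExpStructure exp
  induction t with
  | var i =>
    rcases i with i | i
    · exact .const (w i)
    · exact .id
  | func f ts ih =>
    cases f with
    | zero => exact .const 0
    | one => exact .const 1
    | add => exact (ih 0).add (ih 1)
    | mul => exact (ih 0).mul (ih 1)
    | exp => exact (ih 0).exp

theorem termValue_relabel {m n : ℕ} (t : LOrExp.Term (Fin m ⊕ Unit)) (g : Fin m → Fin n)
    (w : Fin n → R) (x : R) :
    termValue exp (t.relabel (Sum.map g id)) w x = termValue exp t (w ∘ g) x := by
  let := orExpStructure exp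
  rw [termValue, termValue, Term.realize_relabel, Sum.elim_comp_map, Function.comp_id]

/-- This lets the scheme for terms apply to the auxiliary functions of the proof: constants become
parameters, and parameter lists are concatenated. -/
theorem IsExpFun.exists_term {f : R → R} (hf : IsExpFun exp f) :
    ∃ (n : ℕ) (t : LOrExp.Term (Fin n ⊕ Unit)) (w : Fin n → R), ∀ x, termValue exp t w x = f x := by
  have merge : ∀ {f g : R → R} (F : OrExpFunc 2) (op : R → R → R),
      (∀ v, (orExpStructure exp).funMap F v = op (v 0) (v 1)) →
      (∃ (n : ℕ) (t : LOrExp.Term (Fin n ⊕ Unit)) (w : Fin n → R),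
        ∀ x, termValue exp t w x = f x) →
      (∃ (n : ℕ) (t : LOrExp.Term (Fin n ⊕ Unit)) (w : Fin n → R),
        ∀ x, termValue exp t w x = g x) →
      ∃ (n : ℕ) (t : LOrExp.Term (Fin n ⊕ Unit)) (w : Fin n → R),
        ∀ x, termValue exp t w x = op (f x) (g x) := by
    rintro f g F op hF ⟨m, t, w, ht⟩ ⟨n, s, u, hs⟩
    refine ⟨m + n, Functions.apply₂ (L := LOrExp) F (t.relabel (Sum.map (Fin.castAdd n) _root_.id))
      (s.relabel (Sum.map (Fin.natAdd m) _root_.id)), Fin.append w u, fun x => ?_⟩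
    have h1 := termValue_relabel (exp := exp) t (Fin.castAdd n) (Fin.append w u) x
    have h2 := termValue_relabel (exp := exp) s (Fin.natAdd m) (Fin.append w u) x
    rw [show Fin.append w u ∘ Fin.castAdd n = w from funext (Fin.append_left w u), ht] at h1
    rw [show Fin.append w u ∘ Fin.natAdd m = u from funext (Fin.append_right w u), hs] at h2
    rw [← h1, ← h2]
    exact hF _
  induction hf with
  | const a => exact ⟨1, Term.var (Sum.inl 0), fun _ => a, fun x => rfl⟩
  | id => exact ⟨0, Term.var (Sum.inr ()), Fin.elim0, fun x => rfl⟩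
  | add _ _ ihf ihg => exact merge .add (· + ·) (fun _ => rfl) ihf ihg
  | mul _ _ ihf ihg => exact merge .mul (· * ·) (fun _ => rfl) ihf ihg
  | exp _ ih =>
    obtain ⟨n, t, w, ht⟩ := ih
    exact ⟨n, Functions.apply₁ (L := LOrExp) OrExpFunc.exp t, w, fun x => congrArg exp (ht x)⟩

theorem realize_plug {n m : ℕ} (t : LOrExp.Term (Fin n ⊕ Unit)) (s : LOrExp.Term (Fin n ⊕ Fin m))
    (w : Fin n → R) (xs : Fin m → R) :
    letI := orExpStructure exp
    (OrExp.plug t s).realize (Sum.elim w xs) = termValue exp t w (s.realize (Sum.elim w xs)) := by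
  let := orExpStructure exp
  rw [OrExp.plug, Term.realize_subst, termValue]
  congr 1
  funext a
  rcases a with a | a <;> rfl

theorem attainsMax_of_fieldModels (hmax : FieldModels exp OrExp.MaxVal) : AttainsMax exp := by
  intro f hf x y hxy
  rcases hxy.eq_or_lt with rfl | hxy
  · exact ⟨x, ⟨le_rfl, le_rfl⟩, fun z hz => by rw [le_antisymm hz.2 hz.1]⟩
  obtain ⟨n, t, w, ht⟩ := hf.exists_term
  let := orExpStructure exp
  have := orderedStructure_orExp exp
  have h : R ⊨ OrExp.maxVal t := (Theory.model_iff _).1 hmax _ ⟨n, t, rfl⟩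
  simp only [OrExp.maxVal, univClosure, Sentence.Realize, Formula.realize_iAlls,
    Formula.realize_relabel] at h
  have h := h w
  simp [Formula.Realize, realize_plug, Term.realize_lt, Term.realize_le, Fin.snoc, ht] at h
  obtain ⟨m, hm, hmz⟩ := h x y hxy
  exact ⟨m, hm, fun z hz => hmz z hz.1 hz.2⟩

theorem fieldModels_intVal (h : ∀ f, IsExpFun exp f → ∀ x y, x < y → f x ≤ 0 → 0 ≤ f y →
    ∃ z ∈ Set.Icc x y, f z = 0) : FieldModels exp OrExp.IntVal := by
  let := orExpStructure exp
  have := orderedStructure_orExp exp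
  refine (Theory.model_iff _).2 ?_
  rintro _ ⟨n, t, rfl⟩
  simp only [OrExp.intVal, univClosure, Sentence.Realize, Formula.realize_iAlls,
    Formula.realize_relabel]
  intro w
  simp [Formula.Realize, realize_plug, Term.realize_lt, Term.realize_le, Fin.snoc]
  have hzero : ∀ {k} (v : Fin n ⊕ Fin k → R), (OrExp.zero : LOrExp.Term _).realize v = 0 :=
    fun _ => rfl
  simp only [hzero]
  intro x y hxy hx hy
  obtain ⟨z, hz, hfz⟩ := h _ (isExpFun_termValue t w) x y hxy hx hy
  exact ⟨z, hz, hfz⟩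

theorem IsExponentialField.exists_zero (h : IsExponentialField exp) (hmax : AttainsMax exp)
    (h_one : exp 1 = 2) {f : R → R} (hf : IsExpFun exp f) {x y : R} (hxy : x ≤ y)
    (hx : f x ≤ 0) (hy : 0 ≤ f y) : ∃ z ∈ Set.Icc x y, f z = 0 := by
  obtain ⟨c, hc⟩ := h.exists_hasUniformDeriv hmax h_one
  by_contra! h0
  rcases h.pos_or_neg hmax hc hf h0 with h1 | h1
  · exact (h1 x ⟨le_rfl, hxy⟩).not_ge hx
  · exact (h1 y ⟨hxy, le_rfl⟩).not_ge hy

theorem IsExponentialField.isFiniteUnionOfIntervals_le (h : IsExponentialField exp)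
    (hmax : AttainsMax exp) (h_one : exp 1 = 2) {f g : R → R} (hf : IsExpFun exp f)
    (hg : IsExpFun exp g) : IsFiniteUnionOfIntervals {x | f x ≤ g x} := by
  obtain ⟨S, hS⟩ := h.exists_sign_eq hmax h_one (hf.sub hg)
  refine isFiniteUnionOfIntervals_of_forall_Icc S fun p q hpq hd => ?_
  have := hS p q hpq hd
  simp only [Set.mem_ofPred_eq]
  rw [← sub_nonpos, ← sub_nonpos (a := f q), ← sign_nonpos_iff, ← sign_nonpos_iff (a := f q - g q)]
  exact iff_of_eq (congrArg (· ≤ 0) this)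

end FieldSide

/-! ### Open induction in exponential integer parts -/

section IntegerPart

variable {R : Type*} [Field R] [LinearOrder R] [IsStrictOrderedRing R] {exp : R → R}
  {M : Subring R}

/-- Induction in an integer part, for properties that propagate to the right off a finite set. -/
theorem IsExpIntegerPart.induction (hM : IsExpIntegerPart exp M) {P : R → Prop} (S : Finset R)
    (hP : ∀ p ∈ M, ∀ q ∈ M, 0 ≤ p → p ≤ q → Disjoint (Set.Icc p q) ↑S → P p → P q)
    (h0 : P 0) (hsucc : ∀ m ∈ M, 0 ≤ m → P m → P (m + 1)) : ∀ m ∈ M, 0 ≤ m → P m := by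
  classical
  -- Strong induction on the number of exceptional points in `[0, m]`.
  set T : R → Finset R := fun m => S.filter fun s => 0 ≤ s ∧ s ≤ m with hT
  have key : ∀ n, ∀ m ∈ M, 0 ≤ m → (T m).card = n → P m := by
    intro n
    induction n using Nat.strong_induction_on with
    | _ n ih =>
    intro m hmM hm hn
    have lt_one : ∀ a ∈ M, ∀ b ∈ M, a < b → a + 1 ≤ b := fun a ha b hb hab => by
      linarith [hM.discrete (b - a) (M.sub_mem hb ha) (sub_pos.2 hab)]
    rcases (T m).eq_empty_or_nonempty with hE | hne
    · refine hP 0 M.zero_mem m hmM le_rfl hm (Set.disjoint_left.2 fun s hs hsS => ?_) h0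
      have : s ∈ T m := Finset.mem_filter.2 ⟨hsS, hs.1, hs.2⟩
      rw [hE] at this
      exact Finset.notMem_empty _ this
    set s := (T m).max' hne with hs
    have hsT : s ∈ T m := (T m).max'_mem hne
    obtain ⟨hsS, hs0, hsm⟩ := Finset.mem_filter.1 hsT
    -- The last exceptional point `s` lies in `[k, k + 1)`. Below it, `k - 1` sees fewer exceptional
    -- points; two successor steps cross it, and `[k + 1, m]` contains none.
    obtain ⟨k, hkM, hks, hsk⟩ := hM.exists_floor s
    have hk : 0 ≤ k := by
      by_contra hk
      push Not at hk
      linarith [lt_one k hkM 0 M.zero_mem hk]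
    have hPk : P k := by
      rcases hk.eq_or_lt with rfl | hk'
      · exact h0
      have h1 := lt_one 0 M.zero_mem k hkM hk'
      rw [← sub_add_cancel k 1]
      have hkM' := M.sub_mem hkM M.one_mem
      refine hsucc _ hkM' (by linarith) (ih _ ?_ _ hkM' (by linarith) rfl)
      rw [← hn]
      refine Finset.card_lt_card ((Finset.ssubset_iff_of_subset fun x hx => ?_).2 ⟨s, hsT, ?_⟩)
      · obtain ⟨hx1, hx2, hx3⟩ := Finset.mem_filter.1 hx
        exact Finset.mem_filter.2 ⟨hx1, hx2, by linarith⟩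
      · intro hx
        linarith [(Finset.mem_filter.1 hx).2.2]
    rcases (hks.trans hsm).eq_or_lt with rfl | hkm
    · exact hPk
    have hk1 := lt_one k hkM m hmM hkm
    refine hP (k + 1) (M.add_mem hkM M.one_mem) m hmM (by linarith) hk1
      (Set.disjoint_left.2 fun x hx hxS => ?_) (hsucc k hkM hk hPk)
    have := (T m).le_max' x (Finset.mem_filter.2 ⟨hxS, by linarith [hx.1], hx.2⟩)
    linarith [hx.1]
  exact fun m hmM hm => key _ m hmM hm rfl

theorem orderedStructure_arExp (hM : IsExpIntegerPart exp M) :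
    letI := arExpStructure hM
    LArExp.OrderedStructure (nonnegPart M) :=
  letI := arExpStructure hM
  ⟨fun _ => Iff.rfl⟩

theorem exists_isExpFun_realize (hM : IsExpIntegerPart exp M) {α : Type}
    (t : LArExp.Term (α ⊕ Unit)) (v : α → nonnegPart M) :
    letI := arExpStructure hM
    ∃ f, IsExpFun exp f ∧ ∀ x : nonnegPart M,
      ((t.realize (Sum.elim v fun _ => x) : nonnegPart M) : R) = f x := by
  let := arExpStructure hM
  induction t with
  | var i =>
    rcases i with i | i
    · exact ⟨_, .const (v i : R), fun x => rfl⟩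
    · exact ⟨_, .id, fun x => rfl⟩
  | func F ts ih =>
    cases F with
    | zero => exact ⟨_, .const 0, fun x => rfl⟩
    | succ =>
      obtain ⟨f, hf, h⟩ := ih 0
      exact ⟨_, hf.add (.const 1), fun x => congrArg (· + 1) (h x)⟩
    | add =>
      obtain ⟨f, hf, h⟩ := ih 0
      obtain ⟨g, hg, h'⟩ := ih 1
      exact ⟨_, hf.add hg, fun x => congrArg₂ (· + ·) (h x) (h' x)⟩
    | mul =>
      obtain ⟨f, hf, h⟩ := ih 0
      obtain ⟨g, hg, h'⟩ := ih 1
      exact ⟨_, hf.mul hg, fun x => congrArg₂ (· * ·) (h x) (h' x)⟩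
    | exp =>
      obtain ⟨f, hf, h⟩ := ih 0
      exact ⟨_, hf.exp, fun x => congrArg exp (h x)⟩

/-- The truth value of a quantifier-free formula in one variable is locally constant off a finite
set. -/
theorem exists_finset_realize_iff (h : IsExponentialField exp) (hmax : AttainsMax exp)
    (h_one : exp 1 = 2) (hM : IsExpIntegerPart exp M) {α : Type} {k : ℕ}
    {φ : LArExp.BoundedFormula (α ⊕ Unit) k} (hφ : φ.IsQF) (v : α → nonnegPart M)
    (xs : Fin k → nonnegPart M) :
    letI := arExpStructure hM
    ∃ S : Finset R, ∀ p q : nonnegPart M, p ≤ q → Disjoint (Set.Icc (p : R) q) ↑S →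
      (φ.Realize (Sum.elim v fun _ => p) xs ↔ φ.Realize (Sum.elim v fun _ => q) xs) := by
  classical
  let := arExpStructure hM
  have term : ∀ t : LArExp.Term ((α ⊕ Unit) ⊕ Fin k), ∃ f, IsExpFun exp f ∧
      ∀ x : nonnegPart M,
        ((t.realize (Sum.elim (Sum.elim v fun _ => x) xs) : nonnegPart M) : R) = f x := by
    intro t
    obtain ⟨f, hf, hft⟩ := exists_isExpFun_realize hM
      (t.relabel (Sum.elim (Sum.map Sum.inl id) (Sum.inl ∘ Sum.inr))) (Sum.elim v xs)
    refine ⟨f, hf, fun x => ?_⟩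
    rw [← hft, Term.realize_relabel]
    congr 2
    funext a
    rcases a with (a | a) | a <;> rfl
  have sign : ∀ t s : LArExp.Term ((α ⊕ Unit) ⊕ Fin k), ∃ S : Finset R,
      ∀ p q : nonnegPart M, p ≤ q → Disjoint (Set.Icc (p : R) q) ↑S →
      ((t.realize (Sum.elim (Sum.elim v fun _ => p) xs) ≤
          s.realize (Sum.elim (Sum.elim v fun _ => p) xs) ↔
        t.realize (Sum.elim (Sum.elim v fun _ => q) xs) ≤
          s.realize (Sum.elim (Sum.elim v fun _ => q) xs))) := by
    intro t s
    obtain ⟨f, hf, hft⟩ := term t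
    obtain ⟨g, hg, hgs⟩ := term s
    obtain ⟨S, hS⟩ := h.exists_sign_eq hmax h_one (hf.sub hg)
    refine ⟨S, fun p q hpq hd => ?_⟩
    have := hS p q hpq hd
    rw [← Subtype.coe_le_coe, ← Subtype.coe_le_coe, hft, hgs, hft, hgs, ← sub_nonpos,
      ← sub_nonpos (a := f q), ← sign_nonpos_iff, ← sign_nonpos_iff (a := f q - g q)]
    exact iff_of_eq (congrArg (· ≤ 0) this)
  induction hφ with
  | falsum => exact ⟨∅, fun _ _ _ _ => Iff.rfl⟩
  | of_isAtomic hφ =>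
    cases hφ with
    | equal t s =>
      obtain ⟨S, hS⟩ := sign t s
      obtain ⟨S', hS'⟩ := sign s t
      refine ⟨S ∪ S', fun p q hpq hd => ?_⟩
      rw [Finset.coe_union, Set.disjoint_union_right] at hd
      rw [BoundedFormula.realize_bdEqual, BoundedFormula.realize_bdEqual, le_antisymm_iff,
        le_antisymm_iff, hS p q hpq hd.1, hS' p q hpq hd.2]
    | rel r ts =>
      cases r with
      | le => exact sign (ts 0) (ts 1)
  | imp _ _ ih₁ ih₂ =>
    obtain ⟨S, hS⟩ := ih₁
    obtain ⟨S', hS'⟩ := ih₂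
    refine ⟨S ∪ S', fun p q hpq hd => ?_⟩
    rw [Finset.coe_union, Set.disjoint_union_right] at hd
    rw [BoundedFormula.realize_imp, BoundedFormula.realize_imp, hS p q hpq hd.1,
      hS' p q hpq hd.2]

theorem integerPartModels_robinsonQ (hM : IsExpIntegerPart exp M) :
    IntegerPartModels hM ArExp.robinsonQ := by
  let := arExpStructure hM
  have := orderedStructure_arExp hM
  have hzero : ∀ {k} (v : Empty ⊕ Fin k → nonnegPart M),
      (ArExp.zero : LArExp.Term _).realize v = 0 := fun _ => rfl
  have hsucc : ∀ {k} (t) (v : Empty ⊕ Fin k → nonnegPart M),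
      (ArExp.succ t : LArExp.Term _).realize v = t.realize v + 1 := fun _ _ => rfl
  have hadd : ∀ {k} (t s) (v : Empty ⊕ Fin k → nonnegPart M),
      (ArExp.add t s : LArExp.Term _).realize v = t.realize v + s.realize v := fun _ _ _ => rfl
  have hmul : ∀ {k} (t s) (v : Empty ⊕ Fin k → nonnegPart M),
      (ArExp.mul t s : LArExp.Term _).realize v = t.realize v * s.realize v := fun _ _ _ => rfl
  refine (Theory.model_iff _).2 ?_
  intro φ hφ
  simp only [ArExp.robinsonQ, Set.mem_insert_iff, Set.mem_singleton_iff] at hφ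
  rcases hφ with rfl | rfl | rfl | rfl | rfl | rfl | rfl | rfl <;>
    simp only [Sentence.Realize, Formula.Realize, BoundedFormula.realize_all,
      BoundedFormula.realize_ex, BoundedFormula.realize_not, BoundedFormula.realize_imp,
      BoundedFormula.realize_iff, BoundedFormula.realize_bdEqual, Term.realize_le, hzero, hsucc,
      hadd, hmul, Function.comp_apply, Term.realize_var, Sum.elim_inr, Fin.snoc]
  · intro x hx
    have h1 : (x : R) + 1 = 0 := congrArg Subtype.val hx
    have h2 : (0 : R) ≤ x := x.2.2
    linarith
  · exact fun x y hxy => Subtype.ext (add_right_cancel (congrArg Subtype.val hxy))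
  · intro x hx
    have h1 : (0 : R) < x := lt_of_le_of_ne x.2.2 fun h0 => hx (Subtype.ext h0.symm)
    have h2 := hM.discrete x x.2.1 h1
    exact ⟨⟨x - 1, M.sub_mem x.2.1 M.one_mem, sub_nonneg.2 h2⟩,
      Subtype.ext (sub_add_cancel (x : R) 1).symm⟩
  · exact fun x => add_zero x
  · exact fun x y => (add_assoc x y 1).symm
  · exact fun x => mul_zero x
  · exact fun x y => (mul_add x y 1).trans (by rw [mul_one]; rfl)
  · intro x y
    constructor
    · intro hxy
      exact ⟨⟨y - x, M.sub_mem y.2.1 x.2.1, sub_nonneg.2 hxy⟩, Subtype.ext (sub_add_cancel _ _)⟩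
    · rintro ⟨r, hr⟩
      have h1 : (r : R) + x = y := congrArg Subtype.val hr
      have h2 : (0 : R) ≤ r := r.2.2
      exact (by linarith : (x : R) ≤ y)

theorem integerPartModels_expAxioms (h : IsExponentialField exp) (h_one : exp 1 = 2)
    (hM : IsExpIntegerPart exp M) : IntegerPartModels hM ArExp.expAxioms := by
  let := arExpStructure hM
  refine (Theory.model_iff _).2 ?_
  rintro φ (rfl | rfl)
  · exact Subtype.ext (h.map_zero.trans (zero_add 1).symm)
  · intro x
    refine Subtype.ext ((h.map_add x 1).trans ?_)
    rw [h_one, mul_two]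
    rfl

theorem integerPartModels_induction (h : IsExponentialField exp) (hmax : AttainsMax exp)
    (h_one : exp 1 = 2) (hM : IsExpIntegerPart exp M) {n : ℕ}
    {φ : LArExp.Formula (Fin n ⊕ Unit)} (hφ : φ.IsQF) :
    letI := arExpStructure hM
    nonnegPart M ⊨ ArExp.induction φ := by
  let := arExpStructure hM
  simp only [ArExp.induction, univClosure, Sentence.Realize, Formula.realize_iAlls,
    Formula.realize_relabel, Formula.realize_imp, Formula.realize_inf]
  rintro v ⟨h0, hsucc⟩ x
  rw [Formula.Realize, BoundedFormula.realize_subst] at h0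
  obtain ⟨S, hS⟩ := exists_finset_realize_iff h hmax h_one hM hφ v default
  have key := hM.induction S
    -- Quantifying over membership proofs makes the property defined on all of `R`.
    (P := fun r => ∀ hr : r ∈ nonnegPart M, φ.Realize (Sum.elim v fun _ => ⟨r, hr⟩))
    (fun p hp q hq hp0 hpq hd hpP hqm => (hS ⟨p, hp, hp0⟩ ⟨q, hqm⟩ hpq hd).1 (hpP _))
    (fun _ => by
      refine (congrArg (BoundedFormula.Realize φ · default) (funext fun a => ?_)).mp h0
      rcases a with a | a <;> rfl)
    (fun m hm hm0 hmP _ => by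
      have := hsucc (fun _ => ⟨m, hm, hm0⟩) (hmP _)
      rw [Formula.Realize, BoundedFormula.realize_subst] at this
      refine (congrArg (BoundedFormula.Realize φ · default) (funext fun a => ?_)).mp this
      rcases a with a | a <;> rfl)
  exact key _ (x ()).2.1 (x ()).2.2 (x ()).2

end IntegerPart

theorem theorem2p3 {R : Type*} [Field R] [LinearOrder R] [IsStrictOrderedRing R]
    (exp : R → R) (hexp : IsExponentialField exp)
    (hmax : FieldModels exp OrExp.MaxVal) (h_one : exp 1 = 2) :
    (∀ (M : Subring R) (hM : IsExpIntegerPart exp M), IntegerPartModels hM ArExp.IOpen) ∧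
      FieldModels exp OrExp.IntVal ∧
      ∀ (n : ℕ) (t₁ t₂ : LOrExp.Term (Fin n ⊕ Unit)) (w : Fin n → R),
        IsFiniteUnionOfIntervals {x | termValue exp t₁ w x ≤ termValue exp t₂ w x} := by
  have hmax := attainsMax_of_fieldModels hmax
  refine ⟨fun M hM => ?_, fieldModels_intVal fun f hf x y hxy => ?_, fun n t₁ t₂ w => ?_⟩
  · let := arExpStructure hM
    refine (Theory.model_iff _).2 ?_
    rintro φ ((hφ | hφ) | ⟨n, ψ, hψ, rfl⟩)
    · exact (Theory.model_iff _).1 (integerPartModels_robinsonQ hM) φ hφ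
    · exact (Theory.model_iff _).1 (integerPartModels_expAxioms hexp h_one hM) φ hφ
    · exact integerPartModels_induction hexp hmax h_one hM hψ
  · exact hexp.exists_zero hmax h_one hf hxy.le
  · exact hexp.isFiniteUnionOfIntervals_le hmax h_one (isExpFun_termValue t₁ w)
      (isExpFun_termValue t₂ w)
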